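/- Let $a\ge 0$ and $b>0$. For $t>0$ put $$f_{1/2}^{\alpha}(t)=\frac{e^{-\alpha t}t^{-1/2}}{\Gamma(1/2)},\qquad m_a(t)=2\Big\{f_{1/2}^{a^2}(t)+a^2\int_0^t f_{1/2}^{a^2}(s)\,ds-a\Big\},\qquad (M_af)(t)=\int_0^t m_a(t-s)f(s)\,ds,$$ $$E(\zeta)=b\zeta^2+a(\zeta-1)^2,\qquad \operatorname{grad}E(\zeta)=E'(\zeta)=2b\zeta+2a(\zeta-1),$$ $$\operatorname{erfc}(s)=\frac{2}{\sqrt\pi}\int_s^\infty e^{-\tau^2}d\tau,\qquad q^\mu(t)=f_{1/2}^0(t)-\mu e^{\mu^2t}\operatorname{erfc}(\mu\sqrt t).$$ For $\lambda>0$ let $G^a_\lambda(y)=\dfrac{e^{-\sqrt{\lambda+a^2}|y|}}{2\sqrt{\lambda+a^2}}$ and, for bounded $w_0$, let $g^a(\lambda,w_0)=\int_{\mathbf R}G^a_\lambda(-z)w_0(z)\,dz$. Let $\mathcal L[g](\lambda)=\int_0^\infty e^{-\lambda s}g(s)\,ds$ be the Laplace transform, and let $\mathcal L^{-1}[\Phi]$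 be the continuous function $H$ on $(0,\infty)$ such that, for every $\lambda>0$, $e^{-\lambda s}H(s)$ is integrable on $(0,\infty)$ and $\mathcal L[H](\lambda)=\Phi(\lambda)$. A bounded solution with initial value $V_0$ means a bounded continuous function $V(y,t)$ on $\mathbf R\times[0,\infty)$ with $V(\cdot,0)=V_0$ that satisfies $$V_t=V_{yy}-a^2(V-1)-2b\,\delta(y)\,V\qquad\text{in }\mathbf R\times(0,\infty)$$ in the sense of distributions, $\delta$ being the Dirac delta at $y=0$. For a function $R$ on $(0,\infty)$, "$\xi$ solves $M_a\xi_t+R=-\operatorname{grad}E(\xi)$" means: $\xi$ is continuous on $[0,\infty)$ and differentiable on $(0,\infty)$, $\xi_t$ is integrable on $(0,T)$ for every $T>0$, and for every $t>0$ the integral $(M_a\xi_t)(t)$ converges absolutely and the equation holds at $t$. (i) Let $w_0$ be bounded and Lipschitz continuous on $\mathbf R$. Then $\mathcal L^{-1}\big[2\sqrt{\lambda+a^2}\,g^a(\lambda,w_0)\big]$ exists, and if $V$ is a bounded solution with initial value $1+w_0$, then $\xi(t)=V(0,t)$ solves $$M_a\xi_t+m_a\,(\xi(0)-1)-\mathcal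 L^{-1}\big[2\sqrt{\lambda+a^2}\,g^a(\lambda,w_0)\big]=-\operatorname{grad}E(\xi).$$ (ii) Let $w_0(x)=-ce^{-\mu|x|}$ with $c\in\mathbf R$ and $\mu\ge0$. If $V$ is a bounded solution with initial value $1+w_0$, then $\xi(t)=V(0,t)$ solves $$M_a\xi_t+2ca\operatorname{erfc}(a\sqrt t)-2c\mu e^{(\mu^2-a^2)t}\operatorname{erfc}(\mu\sqrt t)=-\operatorname{grad}E(\xi),$$ and $\xi=1+\eta$ on $[0,\infty)$, where $$\eta(t)=c\Big[(\mu+b)\int_0^te^{-\mu^2s}q^b(s)\,ds-1\Big]e^{-(a^2-\mu^2)t}-b\int_0^te^{-a^2s}q^b(s)\,ds.$$ Moreover, $1+\eta$ is the unique solution of this equation with $\xi(0)=1-c$. -/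

import Mathlib

open Real Set MeasureTheory
open scoped ContDiff

noncomputable section

namespace LimitEq

/-- The Laplace transform `𝓛[g](lam) = ∫₀^∞ e^{-lam s} g(s) ds`. -/
def laplace (g : ℝ → ℝ) (lam : ℝ) : ℝ :=
  ∫ s in Ioi (0 : ℝ), exp (-lam * s) * g s

/-- `H` is the continuous inverse Laplace transform `𝓛⁻¹[Φ]` on `(0,∞)`: it is continuous there,
and for every `lam > 0` its Laplace integral converges absolutely and has the value `Φ lam`. -/
structure IsInverseLaplace (Φ H : ℝ → ℝ) : Prop where
  continuousOn : ContinuousOn H (Ioi 0)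
  integrable : ∀ lam > 0, IntegrableOn (fun s => exp (-lam * s) * H s) (Ioi 0)
  laplace_eq : ∀ lam > 0, laplace H lam = Φ lam

/-- `f_β^α(t) = e^{-αt} t^{β-1} / Γ(β)` (used for `t > 0`). -/
def fKer (α β t : ℝ) : ℝ := exp (-α * t) * t ^ (β - 1) / Gamma β

/-- The memory kernel `m_a(t) = 2 (f_{1/2}^{a²}(t) + a² ∫₀ᵗ f_{1/2}^{a²}(s) ds - a)`. -/
def mKer (a t : ℝ) : ℝ :=
  2 * (fKer (a ^ 2) (1 / 2) t + a ^ 2 * (∫ s in (0 : ℝ)..t, fKer (a ^ 2) (1 / 2) s) - a)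

/-- The operator `(M_a f)(t) = (m_a * f)(t) = ∫₀ᵗ m_a(t-s) f(s) ds`. -/
def memOp (a : ℝ) (f : ℝ → ℝ) (t : ℝ) : ℝ := ∫ s in (0 : ℝ)..t, mKer a (t - s) * f s

/-- The limit energy `E_sMM^{0,b}(ζ) = b ζ² + a (ζ-1)²`. -/
def energy (a b ζ : ℝ) : ℝ := b * ζ ^ 2 + a * (ζ - 1) ^ 2

/-- The Green function `G_lam^a` of `-∂_y² + (lam + a²)` on the line. -/
def green (a lam y : ℝ) : ℝ := exp (-√(lam + a ^ 2) * |y|) / (2 * √(lam + a ^ 2))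

/-- The spatial convolution `(G_lam^a *ₓ w₀)(y)`. -/
def greenConv (a lam : ℝ) (w₀ : ℝ → ℝ) (y : ℝ) : ℝ := ∫ z, green a lam (y - z) * w₀ z

/-- `g^a(lam, w₀) = (G_lam^a *ₓ w₀)(0)`. -/
def gVal (a lam : ℝ) (w₀ : ℝ → ℝ) : ℝ := greenConv a lam w₀ 0

/-- `erfc(s) = (2/√π) ∫ₛ^∞ e^{-τ²} dτ`. -/
def erfc (s : ℝ) : ℝ := 2 / √π * ∫ τ in Ioi s, exp (-τ ^ 2)

/-- `q^μ(t) = f_{1/2}^0(t) - μ e^{μ² t} erfc(μ √t)`. -/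
def qKer (μ t : ℝ) : ℝ := fKer 0 (1 / 2) t - μ * exp (μ ^ 2 * t) * erfc (μ * √t)

/-- `V = V(y,t)` is a bounded solution on `ℝ × (0,∞)`, in the sense of distributions, of
`V_t = V_yy - a² (V - 1) - 2 b δ(y) V` (`δ` being the distributional derivative of the Heaviside
function `1_{y>0}`), and it is continuous up to `t = 0` with initial value `V(·,0) = V₀`. -/
structure IsBoundedSolution (a b : ℝ) (V₀ : ℝ → ℝ) (V : ℝ → ℝ → ℝ) : Prop where
  continuousOn : ContinuousOn (fun p : ℝ × ℝ => V p.1 p.2) {p | 0 ≤ p.2}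
  bounded : ∃ C : ℝ, ∀ y t : ℝ, 0 ≤ t → |V y t| ≤ C
  initial : ∀ y, V y 0 = V₀ y
  equation : ∀ φ : ℝ × ℝ → ℝ, ContDiff ℝ ∞ φ → HasCompactSupport φ →
    tsupport φ ⊆ {p | 0 < p.2} →
      (∫ t in Ioi (0 : ℝ), ∫ y : ℝ,
        (V y t * (deriv (fun s => φ (y, s)) t + iteratedDeriv 2 (fun z => φ (z, t)) y)
          - a ^ 2 * (V y t - 1) * φ (y, t)))
      = 2 * b * ∫ t in Ioi (0 : ℝ), V 0 t * φ (0, t)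

/-- `ξ` solves `M_a ξ_t + R = -grad E_sMM^{0,b}(ξ)` for every `t > 0`: it is continuous on `[0,∞)`
and differentiable on `(0,∞)`, its derivative is integrable on `(0,T)` for every `T`, the integral
`(M_a ξ_t)(t)` converges absolutely for every `t > 0`, and the equation holds. -/
structure SolvesMemoryEq (a b : ℝ) (R ξ : ℝ → ℝ) : Prop where
  continuousOn : ContinuousOn ξ (Ici 0)
  differentiableAt : ∀ t > 0, DifferentiableAt ℝ ξ t
  deriv_integrable : ∀ T > 0, IntervalIntegrable (deriv ξ) volume 0 T
  memory_integrable :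
    ∀ t > 0, IntervalIntegrable (fun s => mKer a (t - s) * deriv ξ s) volume 0 t
  equation : ∀ t > 0, memOp a (deriv ξ) t + R t = -deriv (energy a b) (ξ t)

/-- The source term `2 c a erfc(a √t) - 2 c μ e^{(μ² - a²) t} erfc(μ √t)`. -/
def expSource (a c μ t : ℝ) : ℝ :=
  2 * c * a * erfc (a * √t) - 2 * c * μ * exp ((μ ^ 2 - a ^ 2) * t) * erfc (μ * √t)

/-- The explicit function `ξ = 1 + η`, where
`η(t) = c ((μ+b) ∫₀ᵗ e^{-μ² s} q^b(s) ds - 1) e^{-(a² - μ²) t} - b ∫₀ᵗ e^{-a² s} q^b(s) ds`. -/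
def explicitSol (a b c μ t : ℝ) : ℝ :=
  1 + (c * ((μ + b) * (∫ s in (0 : ℝ)..t, exp (-μ ^ 2 * s) * qKer b s) - 1)
        * exp (-(a ^ 2 - μ ^ 2) * t)
      - b * ∫ s in (0 : ℝ)..t, exp (-a ^ 2 * s) * qKer b s)

end LimitEq

end

namespace LimitEq

open Filter Topology

/-! ### Injectivity of the Laplace transform -/

/-! Write κ = √(λ + a²). In Laplace variables the whole statement is algebra, so the work lies in
making the transform legitimate and in inverting it.

A bounded solution is tested against products τ(t)ψ(y), and its transform L(y) in time then solves
L'' = κ²L - F + 2b L(0) δ weakly, with F = 1 + w₀ + a²/λ. Since |y|'' = 2δ, subtracting b L(0)|y|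
removes the delta and leaves a classical second order equation. Multiplying by e^{-κ|y|} and
integrating over the two half-lines, where boundedness kills the terms at infinity, gives L(0) =
κ(1/λ + g^a)/(κ + b) (`laplace_trace`).

Independently, a function ξ = ξ(0) + ∫D with this transform is built by hand (`exists_trace`).
Lipschitz data make the time derivative of the free heat flow at the origin O(t^{-1/2}); shifting by
a² is multiplication by e^{-a²t}, and division by κ + b is convolution with the kernel e^{-a²t} q^b.
Thus D is continuous on (0,∞) and O(t^{-1/2} e^{κ't}) for some constant κ', a class closed under
convolution (`WeaklySingular`). The kernel m_a has transform 2(κ - a)/λ, so the memory equation for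
ξ reduces to an identity of transforms (`solvesMemoryEq_primitive`). Injectivity of the transform on
continuous functions identifies V(0,·) with ξ; differentiability of the trace thus comes from ξ and
no regularity theory for the PDE is needed.

For exponential data g^a is explicit, and the source and 1 + η are recognised by their transforms.
Uniqueness rests on (κ - a)(κ + a) = λ: convolving with the kernel of transform (κ + a)/(2λ) turns
the equation for the difference of two solutions into a homogeneous weakly singular Volterra
equation of the second kind, which has only the zero solution (`eq_zero_of_eq_conv`). -/

/-- The Laplace integral of `f` at `lam` converges absolutely. -/
def LapIntegrable (f : ℝ → ℝ) (lam : ℝ) : Prop :=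
  IntegrableOn (fun s => exp (-lam * s) * f s) (Ioi 0)

/-- Under x = e^{-s} the hypotheses say that all moments on (0,1] vanish; Weierstrass approximation
passes from polynomials to continuous functions. -/
lemma integral_continuous_comp_exp_neg_eq_zero {F : ℝ → ℝ} (hF : IntegrableOn F (Ioi 0))
    (h : ∀ n : ℕ, ∫ s in Ioi (0 : ℝ), exp (-s) ^ n * F s = 0) {g : ℝ → ℝ}
    (hg : ContinuousOn g (Icc 0 1)) (hgm : AEStronglyMeasurable (fun s => g (exp (-s)))
      (volume.restrict (Ioi (0 : ℝ)))) : ∫ s in Ioi (0 : ℝ), g (exp (-s)) * F s = 0 := by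
  have hpow : ∀ n : ℕ, IntegrableOn (fun s => exp (-s) ^ n * F s) (Ioi 0) := by
    intro n
    refine hF.bdd_mul (c := 1) (by fun_prop) ?_
    filter_upwards [ae_restrict_mem measurableSet_Ioi] with s hs
    have h1 : exp (-s) ≤ 1 := exp_le_one_iff.2 (by simpa using (mem_Ioi.1 hs).le)
    rw [norm_of_nonneg (by positivity)]
    exact pow_le_one₀ (exp_pos _).le h1
  have hpoly : ∀ p : Polynomial ℝ, ∫ s in Ioi (0 : ℝ), p.eval (exp (-s)) * F s = 0 := by
    intro p
    simp_rw [Polynomial.eval_eq_sum_range, Finset.sum_mul, mul_assoc]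
    rw [integral_finsetSum _ (fun i _ => (hpow i).const_mul _)]
    simp [integral_const_mul, h]
  have hpint : ∀ p : Polynomial ℝ, IntegrableOn (fun s => p.eval (exp (-s)) * F s) (Ioi 0) := by
    intro p
    simp_rw [Polynomial.eval_eq_sum_range, Finset.sum_mul, mul_assoc]
    exact integrable_finsetSum _ (fun i _ => (hpow i).const_mul _)
  set M := ∫ s in Ioi (0 : ℝ), |F s| with hM
  have hM0 : 0 ≤ M := integral_nonneg fun _ => abs_nonneg _
  refine abs_eq_zero.1 (le_antisymm (le_of_forall_pos_le_add fun ε hε => ?_) (abs_nonneg _))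
  obtain ⟨p, hp⟩ := exists_polynomial_near_of_continuousOn 0 1 g hg (ε / (M + 1)) (by positivity)
  have hp' : ∀ s ∈ Ioi (0 : ℝ), |p.eval (exp (-s)) - g (exp (-s))| < ε / (M + 1) := fun s hs =>
    hp _ ⟨(exp_pos _).le, exp_le_one_iff.2 (by simpa using (mem_Ioi.1 hs).le)⟩
  have hdiff : IntegrableOn (fun s => (p.eval (exp (-s)) - g (exp (-s))) * F s) (Ioi 0) := by
    refine hF.bdd_mul (c := ε / (M + 1)) ?_ ?_
    · exact (Continuous.aestronglyMeasurable (by fun_prop)).sub hgm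
    · filter_upwards [ae_restrict_mem measurableSet_Ioi] with s hs using (hp' s hs).le
  have hsplit : ∫ s in Ioi (0 : ℝ), g (exp (-s)) * F s
      = -∫ s in Ioi (0 : ℝ), (p.eval (exp (-s)) - g (exp (-s))) * F s := by
    have := integral_sub (hpint p) hdiff
    rw [hpoly p, zero_sub] at this
    rw [← this]
    exact integral_congr_ae (Eventually.of_forall fun s => by simp only; ring)
  rw [hsplit, abs_neg, zero_add]
  calc |∫ s in Ioi (0 : ℝ), (p.eval (exp (-s)) - g (exp (-s))) * F s|
      ≤ ∫ s in Ioi (0 : ℝ), |(p.eval (exp (-s)) - g (exp (-s))) * F s| :=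
        abs_integral_le_integral_abs
    _ ≤ ∫ s in Ioi (0 : ℝ), ε / (M + 1) * |F s| := by
        refine setIntegral_mono_on hdiff.abs (hF.abs.const_mul _) measurableSet_Ioi fun s hs => ?_
        rw [abs_mul]
        exact mul_le_mul_of_nonneg_right (hp' s hs).le (abs_nonneg _)
    _ = ε / (M + 1) * M := integral_const_mul _ _
    _ ≤ ε := by
        rw [div_mul_eq_mul_div, div_le_iff₀ (by positivity)]
        nlinarith

lemma ae_eq_zero_of_exp_moments_eq_zero {F : ℝ → ℝ} (hF : IntegrableOn F (Ioi 0))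
    (h : ∀ n : ℕ, ∫ s in Ioi (0 : ℝ), exp (-s) ^ n * F s = 0) :
    ∀ᵐ s : ℝ, s ∈ Ioi (0 : ℝ) → F s = 0 := by
  refine isOpen_Ioi.ae_eq_zero_of_integral_contDiff_smul_eq_zero hF.locallyIntegrableOn ?_
  intro φ hφ hc hs
  have hφc : Continuous φ := hφ.continuous
  have h0 : ∀ s ≤ 0, φ s = 0 := fun s hs0 =>
    image_eq_zero_of_notMem_tsupport fun hmem => absurd (hs hmem) (by simpa using hs0)
  -- Near x = 0 this function vanishes, because -log |x| leaves the compact support of φ; at x = 0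
  -- itself the convention `log 0 = 0` gives φ(0) = 0.
  have hg : Continuous fun x : ℝ => φ (-log x) := by
    rw [continuous_iff_continuousAt]
    intro x
    rcases eq_or_ne x 0 with rfl | hx
    · obtain ⟨R, hR⟩ := hc.isCompact.isBounded.subset_closedBall 0
      have hev : (fun x : ℝ => φ (-log x)) =ᶠ[𝓝 0] fun _ => 0 := by
        have h1 : ∀ᶠ x in 𝓝[≠] (0 : ℝ), log x < -R :=
          tendsto_log_nhdsNE_zero.eventually (eventually_lt_atBot _)
        rw [eventually_nhdsWithin_iff] at h1
        filter_upwards [h1] with x hx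
        rcases eq_or_ne x 0 with rfl | hx0
        · simpa using h0 0 le_rfl
        · refine image_eq_zero_of_notMem_tsupport fun hmem => ?_
          have h2 := hR hmem
          rw [mem_closedBall_zero_iff, norm_eq_abs, abs_le] at h2
          linarith [hx hx0, h2.2]
      exact (continuousAt_const.congr hev.symm)
    · exact hφc.continuousAt.comp (continuousAt_log hx).neg
  have := integral_continuous_comp_exp_neg_eq_zero hF h hg.continuousOn
    (hg.comp (by fun_prop : Continuous fun s : ℝ => exp (-s))).aestronglyMeasurable
  simp only [log_exp, neg_neg] at this
  rw [← this, ← integral_indicator measurableSet_Ioi]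
  refine integral_congr_ae (Eventually.of_forall fun s => ?_)
  by_cases hs0 : 0 < s
  · simp [indicator_of_mem (mem_Ioi.2 hs0)]
  · simp [hs0, h0 s (not_lt.1 hs0)]

/-- Fix a large L: the transforms at L + n are the moments of e^{-Ls}(f - g) against powers of
e^{-s}. Agreement at large arguments therefore suffices, and no growth rate has to be tracked. -/
theorem ae_eq_of_laplace_eventuallyEq {f g : ℝ → ℝ} (hf : ∀ᶠ lam in atTop, LapIntegrable f lam)
    (hg : ∀ᶠ lam in atTop, LapIntegrable g lam)
    (h : ∀ᶠ lam in atTop, laplace f lam = laplace g lam) :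
    ∀ᵐ t : ℝ, t ∈ Ioi (0 : ℝ) → f t = g t := by
  obtain ⟨L, hL⟩ := eventually_atTop.1 (hf.and (hg.and h))
  have hF : IntegrableOn (fun s => exp (-L * s) * f s - exp (-L * s) * g s) (Ioi 0) :=
    (hL L le_rfl).1.sub (hL L le_rfl).2.1
  have := ae_eq_zero_of_exp_moments_eq_zero hF ?_
  · filter_upwards [this] with t ht ht0
    have h1 := ht ht0
    rw [← mul_sub] at h1
    linarith [(mul_eq_zero.1 h1).resolve_left (exp_pos _).ne']
  · intro n
    obtain ⟨h1, h2, h3⟩ := hL (L + n) (by simp)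
    have heq : ∀ s, exp (-s) ^ n * (exp (-L * s) * f s - exp (-L * s) * g s)
        = exp (-(L + n) * s) * f s - exp (-(L + n) * s) * g s := by
      intro s
      have : exp (-(L + n) * s) = exp (-s) ^ n * exp (-L * s) := by
        rw [← exp_nat_mul, ← exp_add]; ring_nf
      rw [this]; ring
    simp_rw [heq]
    rw [integral_sub h1 h2, sub_eq_zero]
    exact h3

lemma eqOn_Ioi_of_ae_eq {f g : ℝ → ℝ} (hf : ContinuousOn f (Ioi 0)) (hg : ContinuousOn g (Ioi 0))
    (h : ∀ᵐ t : ℝ, t ∈ Ioi (0 : ℝ) → f t = g t) : EqOn f g (Ioi 0) :=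
  Measure.eqOn_open_of_ae_eq ((ae_restrict_iff' measurableSet_Ioi).2 h) isOpen_Ioi hf hg

/-! ### Laplace transform of a causal convolution -/

/-- The causal convolution `∫₀ᵗ k(t-s) f(s) ds`. -/
noncomputable def conv (k f : ℝ → ℝ) (t : ℝ) : ℝ := ∫ s in (0 : ℝ)..t, k (t - s) * f s

/-- The weight e^{-λt} is multiplicative along t = s + (t - s), which reduces Laplace transforms of
convolutions to Fubini for integrable functions. -/
lemma exp_mul_conv (k f : ℝ → ℝ) (lam t : ℝ) : exp (-lam * t) * conv k f t =
    ∫ s in (0 : ℝ)..t, ContinuousLinearMap.mul ℝ ℝ (exp (-lam * s) * f s)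
      (exp (-lam * (t - s)) * k (t - s)) := by
  rw [conv, ← intervalIntegral.integral_const_mul]
  congr 1
  ext s
  have : exp (-lam * t) = exp (-lam * s) * exp (-lam * (t - s)) := by rw [← exp_add]; ring_nf
  rw [this, ContinuousLinearMap.mul_apply']
  ring

lemma LapIntegrable.conv {k f : ℝ → ℝ} {lam : ℝ} (hk : LapIntegrable k lam)
    (hf : LapIntegrable f lam) : LapIntegrable (conv k f) lam := by
  have := integrable_posConvolution (μ := volume) (ν := volume) hf hk (ContinuousLinearMap.mul ℝ ℝ)
  rw [posConvolution, integrable_indicator_iff measurableSet_Ioi] at this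
  rw [LapIntegrable]
  simpa only [exp_mul_conv] using this

lemma laplace_conv {k f : ℝ → ℝ} {lam : ℝ} (hk : LapIntegrable k lam)
    (hf : LapIntegrable f lam) : laplace (conv k f) lam = laplace k lam * laplace f lam := by
  have := integral_posConvolution (μ := volume) (ν := volume) hf hk (ContinuousLinearMap.mul ℝ ℝ)
  rw [laplace]
  simp only [exp_mul_conv]
  rw [this, ContinuousLinearMap.mul_apply', mul_comm]
  rfl

/-! ### Functions of class `t^{-1/2} e^{κt}` with known Laplace transform -/

lemma integrableOn_exp_div_sqrt {p : ℝ} (hp : 0 < p) :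
    IntegrableOn (fun t => exp (-p * t) / √t) (Ioi 0) := by
  refine (integrableOn_rpow_mul_exp_neg_mul_rpow (s := -(1 / 2)) (p := 1) (b := p) (by norm_num)
    one_pos hp).congr_fun (fun t ht => ?_) measurableSet_Ioi
  have ht' : (0 : ℝ) < t := ht
  simp only [rpow_one]
  rw [rpow_neg ht'.le, ← sqrt_eq_rpow]
  field_simp

lemma integral_exp_div_sqrt {p : ℝ} (hp : 0 < p) :
    ∫ t in Ioi (0 : ℝ), exp (-p * t) / √t = √π / √p := by
  have := integral_rpow_mul_exp_neg_mul_Ioi (a := 1 / 2) (r := p) (by norm_num) hp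
  rw [Gamma_one_half_eq, ← sqrt_eq_rpow, sqrt_div zero_le_one, sqrt_one] at this
  rw [show √π / √p = 1 / √p * √π by ring, ← this]
  refine setIntegral_congr_fun measurableSet_Ioi fun t ht => ?_
  have ht' : (0 : ℝ) < t := ht
  rw [show (1 / 2 - 1 : ℝ) = -(1 / 2) by norm_num, rpow_neg ht'.le, ← sqrt_eq_rpow]
  field_simp

lemma sqrt_le_exp {t : ℝ} (ht : 0 ≤ t) : √t ≤ exp t := by
  have h1 : √t ≤ t + 1 := by nlinarith [sq_sqrt ht, sq_nonneg (√t - 1)]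
  exact h1.trans (add_one_le_exp t)

/-- `f` is continuous on `(0,∞)` and bounded by a multiple of `t^{-1/2} e^{κt}`. -/
structure WeaklySingular (f : ℝ → ℝ) : Prop where
  continuousOn : ContinuousOn f (Ioi 0)
  bound : ∃ C κ : ℝ, 0 ≤ C ∧ 0 ≤ κ ∧ ∀ t > 0, |f t| ≤ C * (exp (κ * t) / √t)

namespace WeaklySingular

variable {f g : ℝ → ℝ}

lemma congr (hf : WeaklySingular f) (h : EqOn g f (Ioi 0)) : WeaklySingular g := by
  obtain ⟨C, κ, hC, hκ, hb⟩ := hf.bound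
  exact ⟨hf.continuousOn.congr h, C, κ, hC, hκ, fun t ht => by rw [h ht]; exact hb t ht⟩

lemma add (hf : WeaklySingular f) (hg : WeaklySingular g) :
    WeaklySingular fun t => f t + g t := by
  obtain ⟨C, κ, hC, hκ, hb⟩ := hf.bound
  obtain ⟨C', κ', hC', hκ', hb'⟩ := hg.bound
  refine ⟨hf.continuousOn.add hg.continuousOn, C + C', max κ κ', by positivity,
    le_max_of_le_left hκ, fun t ht => (abs_add_le _ _).trans ?_⟩
  rw [add_mul]
  refine add_le_add ((hb t ht).trans ?_) ((hb' t ht).trans ?_)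
  · gcongr; exact le_max_left _ _
  · gcongr; exact le_max_right _ _

lemma const_mul (c : ℝ) (hf : WeaklySingular f) : WeaklySingular fun t => c * f t := by
  obtain ⟨C, κ, hC, hκ, hb⟩ := hf.bound
  refine ⟨continuousOn_const.mul hf.continuousOn, |c| * C, κ, by positivity, hκ, fun t ht => ?_⟩
  rw [abs_mul, mul_assoc]
  exact mul_le_mul_of_nonneg_left (hb t ht) (abs_nonneg _)

lemma of_exp_bound (hf : ContinuousOn f (Ioi 0)) {C κ : ℝ} (hκ : 0 ≤ κ)
    (hb : ∀ t > 0, |f t| ≤ C * exp (κ * t)) : WeaklySingular f := by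
  have hC : 0 ≤ C := by
    have := (abs_nonneg _).trans (hb 1 one_pos)
    exact nonneg_of_mul_nonneg_left this (exp_pos _)
  -- The extra e^t pays for the factor √t.
  refine ⟨hf, C, κ + 1, hC, by positivity, fun t ht => (hb t ht).trans ?_⟩
  refine mul_le_mul_of_nonneg_left ?_ hC
  rw [le_div_iff₀ (by positivity), add_mul, one_mul, exp_add]
  exact mul_le_mul_of_nonneg_left (sqrt_le_exp ht.le) (exp_pos _).le

lemma of_bounded (hf : ContinuousOn f (Ioi 0)) {C : ℝ} (hb : ∀ t > 0, |f t| ≤ C) :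
    WeaklySingular f :=
  of_exp_bound (κ := 0) hf le_rfl (C := C) fun t ht => by simpa using hb t ht

lemma exp_mul (c : ℝ) (hf : WeaklySingular f) : WeaklySingular fun t => exp (-c * t) * f t := by
  obtain ⟨C, κ, hC, hκ, hb⟩ := hf.bound
  refine ⟨(Continuous.continuousOn (by fun_prop)).mul hf.continuousOn, C, κ + |c|, hC,
    by positivity, fun t ht => ?_⟩
  rw [abs_mul, abs_exp]
  calc exp (-c * t) * |f t| ≤ exp (|c| * t) * (C * (exp (κ * t) / √t)) := by
        gcongr
        · exact neg_le_abs c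
        · exact hb t ht
    _ = _ := by rw [add_mul, exp_add]; ring

lemma lapIntegrable (hf : WeaklySingular f) : ∀ᶠ lam in atTop, LapIntegrable f lam := by
  obtain ⟨C, κ, hC, hκ, hb⟩ := hf.bound
  filter_upwards [eventually_gt_atTop κ] with lam hlam
  refine Integrable.mono' ((integrableOn_exp_div_sqrt (sub_pos.2 hlam)).const_mul C) ?_ ?_
  · exact ((Continuous.continuousOn (by fun_prop)).mul hf.continuousOn).aestronglyMeasurable
      measurableSet_Ioi
  · filter_upwards [ae_restrict_mem measurableSet_Ioi] with t ht
    rw [norm_mul, norm_of_nonneg (exp_pos _).le]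
    calc exp (-lam * t) * ‖f t‖ ≤ exp (-lam * t) * (C * (exp (κ * t) / √t)) := by
          gcongr; exact hb t ht
      _ = C * (exp (-(lam - κ) * t) / √t) := by
          rw [show -(lam - κ) * t = -lam * t + κ * t by ring, exp_add]; ring

lemma intervalIntegrable (hf : WeaklySingular f) (T : ℝ) (hT : 0 ≤ T) :
    IntervalIntegrable f volume 0 T := by
  obtain ⟨lam, hlam⟩ := hf.lapIntegrable.exists
  rw [intervalIntegrable_iff_integrableOn_Ioc_of_le hT]
  have h1 : IntegrableOn (fun s => exp (-lam * s) * f s) (Ioc 0 T) :=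
    hlam.mono_set Ioc_subset_Ioi_self
  have := h1.continuousOn_mul_of_subset (g := fun s => exp (lam * s)) (by fun_prop) 
    (isCompact_Icc (a := 0) (b := T)) measurableSet_Ioc Ioc_subset_Icc_self
  refine this.congr_fun (fun s _ => ?_) measurableSet_Ioc
  simp only
  rw [← mul_assoc, ← exp_add]
  simp

end WeaklySingular

/-- Since the squares of √r and √(1-r) add up to 1, their sum is at least 1; this splits the
two-sided singularity into two one-sided ones. -/
lemma intervalIntegrable_beta :
    IntervalIntegrable (fun r : ℝ => 1 / (√r * √(1 - r))) volume 0 1 := by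
  have h1 : IntervalIntegrable (fun r : ℝ => 1 / √r) volume 0 1 := by
    refine IntervalIntegrable.congr (fun r hr => ?_)
      (intervalIntegral.intervalIntegrable_rpow' (r := -(1 / 2)) (a := 0) (b := 1) (by norm_num))
    rw [uIoc_of_le zero_le_one] at hr
    rw [rpow_neg hr.1.le, ← sqrt_eq_rpow, one_div]
  have h2 : IntervalIntegrable (fun r : ℝ => 1 / √(1 - r)) volume 0 1 := by
    have := (h1.comp_sub_left 1).symm
    simpa using this
  refine ((h1.add h2).const_mul √2).mono_fun' ?_ ?_
  · exact (by fun_prop : Measurable fun r : ℝ => 1 / (√r * √(1 - r))).aestronglyMeasurable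
  · filter_upwards [ae_restrict_mem measurableSet_uIoc] with r hr
    rw [uIoc_of_le zero_le_one] at hr
    rw [norm_of_nonneg (by positivity)]
    have hr0 : 0 < √r := sqrt_pos.2 hr.1
    rcases eq_or_lt_of_le hr.2 with h | h
    · subst h
      simp
    have hr1 : 0 < √(1 - r) := sqrt_pos.2 (by linarith)
    have hs : √r ^ 2 + √(1 - r) ^ 2 = 1 := by rw [sq_sqrt hr.1.le, sq_sqrt (by linarith)]; ring
    have h3 : 1 ≤ √2 * (√r + √(1 - r)) := by
      have : (1 : ℝ) ≤ √2 := by rw [le_sqrt] <;> norm_num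
      have h4 : 1 ≤ √r + √(1 - r) := by nlinarith [mul_pos hr0 hr1]
      nlinarith
    calc 1 / (√r * √(1 - r)) ≤ (√2 * (√r + √(1 - r))) / (√r * √(1 - r)) := by gcongr
      _ = √2 * (1 / √r + 1 / √(1 - r)) := by field_simp; ring

/-- The substitution s = tr fixes the interval of integration, so that continuity in t becomes
dominated convergence. -/
lemma conv_eq_scaled (k f : ℝ → ℝ) {t : ℝ} (ht : 0 < t) :
    conv k f t = ∫ r in (0 : ℝ)..1, t * (k (t * (1 - r)) * f (t * r)) := by
  have := intervalIntegral.integral_comp_mul_left (a := 0) (b := 1) (fun s => k (t - s) * f s) ht.ne'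
  rw [intervalIntegral.integral_const_mul, conv]
  simp only [mul_zero, mul_one, smul_eq_mul] at this
  rw [show (fun r => k (t * (1 - r)) * f (t * r)) = fun r => k (t - t * r) * f (t * r) by
    ext r; rw [mul_sub, mul_one], this, mul_inv_cancel_left₀ ht.ne']

namespace WeaklySingular

variable {k f : ℝ → ℝ}

/-- The Jacobian t cancels the two factors t^{-1/2}: the convolution of two weakly singular
functions is no longer singular at 0. -/
lemma exists_scaled_bound (hk : WeaklySingular k) (hf : WeaklySingular f) :
    ∃ C κ : ℝ, 0 ≤ C ∧ 0 ≤ κ ∧ ∀ t > 0, ∀ r ∈ Ioo (0 : ℝ) 1,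
      |t * (k (t * (1 - r)) * f (t * r))| ≤ C * exp (κ * t) * (1 / (√r * √(1 - r))) := by
  obtain ⟨C, κ, hC, hκ, hb⟩ := hk.bound
  obtain ⟨C', κ', hC', hκ', hb'⟩ := hf.bound
  refine ⟨C * C', κ + κ', by positivity, by positivity, fun t ht r hr => ?_⟩
  have hr1 : 0 < 1 - r := by linarith [hr.2]
  have hr0 := hr.1
  rw [abs_mul, abs_mul, abs_of_pos ht]
  have e1 : exp (κ * (t * (1 - r))) ≤ exp (κ * t) := by
    gcongr; nlinarith [mul_pos ht hr0]
  have e2 : exp (κ' * (t * r)) ≤ exp (κ' * t) := by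
    gcongr; nlinarith [mul_pos ht hr1]
  calc t * (|k (t * (1 - r))| * |f (t * r)|)
      ≤ t * ((C * (exp (κ * t) / √(t * (1 - r)))) * (C' * (exp (κ' * t) / √(t * r)))) := by
        gcongr
        · exact (hb _ (by positivity)).trans (by gcongr)
        · exact (hb' _ (by positivity)).trans (by gcongr)
    _ = _ := by
        rw [sqrt_mul ht.le, sqrt_mul ht.le, add_mul, exp_add]
        have := mul_self_sqrt ht.le
        have h1 : 0 < √t := sqrt_pos.2 ht
        have h2 : 0 < √r := sqrt_pos.2 hr0
        have h3 : 0 < √(1 - r) := sqrt_pos.2 hr1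
        field_simp
        rw [sq, this]
        ring

lemma ae_uIoc_mem_Ioo : ∀ᵐ r : ℝ, r ∈ uIoc (0 : ℝ) 1 → r ∈ Ioo (0 : ℝ) 1 := by
  have : ∀ᵐ r : ℝ, r ≠ 1 := by simp [ae_iff]
  filter_upwards [this] with r hr hr'
  rw [uIoc_of_le zero_le_one] at hr'
  exact ⟨hr'.1, lt_of_le_of_ne hr'.2 hr⟩

lemma scaled_continuousOn (hk : WeaklySingular k) (hf : WeaklySingular f) {t : ℝ} (ht : 0 < t) :
    ContinuousOn (fun r => t * (k (t * (1 - r)) * f (t * r))) (Ioo 0 1) := by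
  refine continuousOn_const.mul (ContinuousOn.mul ?_ ?_)
  · refine hk.continuousOn.comp (by fun_prop) fun r hr => ?_
    have : 0 < 1 - r := by linarith [hr.2]
    exact mul_pos ht this
  · exact hf.continuousOn.comp (by fun_prop) fun r hr => mul_pos ht hr.1

lemma scaled_aestronglyMeasurable (hk : WeaklySingular k) (hf : WeaklySingular f) {t : ℝ}
    (ht : 0 < t) : AEStronglyMeasurable (fun r => t * (k (t * (1 - r)) * f (t * r)))
      (volume.restrict (uIoc 0 1)) := by
  rw [uIoc_of_le zero_le_one, ← restrict_Ioo_eq_restrict_Ioc]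
  exact (scaled_continuousOn hk hf ht).aestronglyMeasurable measurableSet_Ioo

lemma scaled_intervalIntegrable (hk : WeaklySingular k) (hf : WeaklySingular f) {t : ℝ}
    (ht : 0 < t) :
    IntervalIntegrable (fun r => t * (k (t * (1 - r)) * f (t * r))) volume 0 1 := by
  obtain ⟨C, κ, hC, hκ, hb⟩ := exists_scaled_bound hk hf
  refine (intervalIntegrable_beta.const_mul (C * exp (κ * t))).mono_fun'
    (scaled_aestronglyMeasurable hk hf ht) ?_
  rw [EventuallyLE, ae_restrict_iff' measurableSet_uIoc]
  filter_upwards [ae_uIoc_mem_Ioo] with r hr hr'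
  exact hb t ht r (hr hr')

lemma conv_intervalIntegrable (hk : WeaklySingular k) (hf : WeaklySingular f) {t : ℝ}
    (ht : 0 < t) : IntervalIntegrable (fun s => k (t - s) * f s) volume 0 t := by
  have h := (scaled_intervalIntegrable hk hf ht).const_mul t⁻¹
  have h2 := h.comp_mul_left (c := t⁻¹)
  simp only [zero_div, one_div, inv_inv] at h2
  refine IntervalIntegrable.congr (fun s _ => ?_) h2
  rw [inv_mul_cancel_left₀ ht.ne', mul_sub, mul_inv_cancel_left₀ ht.ne', mul_one]

lemma conv (hk : WeaklySingular k) (hf : WeaklySingular f) : WeaklySingular (conv k f) := by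
  obtain ⟨C, κ, hC, hκ, hb⟩ := exists_scaled_bound hk hf
  set B := ∫ r in (0 : ℝ)..1, 1 / (√r * √(1 - r)) with hB
  refine of_exp_bound (C := C * B) (κ := κ) ?_ hκ ?_
  · intro t ht
    have ht' : (0 : ℝ) < t := ht
    refine ContinuousAt.continuousWithinAt ?_
    have hev : ∀ᶠ u in 𝓝 t, u ∈ Ioo 0 (2 * t) := Ioo_mem_nhds ht' (by linarith)
    have hcongr : LimitEq.conv k f =ᶠ[𝓝 t]
        fun u => ∫ r in (0 : ℝ)..1, u * (k (u * (1 - r)) * f (u * r)) := by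
      filter_upwards [hev] with u hu using conv_eq_scaled k f hu.1
    refine ContinuousAt.congr ?_ hcongr.symm
    refine intervalIntegral.continuousAt_of_dominated_interval
      (bound := fun r => C * exp (κ * (2 * t)) * (1 / (√r * √(1 - r)))) ?_ ?_
      (intervalIntegrable_beta.const_mul _) ?_
    · filter_upwards [hev] with u hu using scaled_aestronglyMeasurable hk hf hu.1
    · filter_upwards [hev] with u hu
      filter_upwards [ae_uIoc_mem_Ioo] with r hr hr'
      refine (hb u hu.1 r (hr hr')).trans ?_
      have := hu.2.le
      gcongr
    · filter_upwards [ae_uIoc_mem_Ioo] with r hr hr'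
      have hr1 := hr hr'
      refine continuousAt_id.mul (ContinuousAt.mul ?_ ?_)
      · refine ContinuousAt.comp (f := fun u => u * (1 - r)) (g := k) ?_ (by fun_prop)
        exact hk.continuousOn.continuousAt (Ioi_mem_nhds (mul_pos ht' (by linarith [hr1.2])))
      · refine ContinuousAt.comp (f := fun u => u * r) (g := f) ?_ (by fun_prop)
        exact hf.continuousOn.continuousAt (Ioi_mem_nhds (mul_pos ht' hr1.1))
  · intro t ht
    rw [conv_eq_scaled k f ht]
    have : ‖∫ r in (0 : ℝ)..1, t * (k (t * (1 - r)) * f (t * r))‖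
        ≤ ∫ r in (0 : ℝ)..1, C * exp (κ * t) * (1 / (√r * √(1 - r))) := by
      refine intervalIntegral.norm_integral_le_of_norm_le zero_le_one ?_
        (intervalIntegrable_beta.const_mul _)
      filter_upwards [ae_uIoc_mem_Ioo] with r hr hr'
      rw [uIoc_of_le zero_le_one] at hr
      exact hb t ht r (hr hr')
    rw [intervalIntegral.integral_const_mul (C * exp (κ * t)), ← hB, norm_eq_abs] at this
    linarith

end WeaklySingular

/-- `f` is weakly singular and its Laplace transform is `Φ` for all large arguments. -/
structure HasLaplace (f Φ : ℝ → ℝ) : Prop extends WeaklySingular f where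
  laplace_eq : ∀ᶠ lam in atTop, laplace f lam = Φ lam

lemma laplace_congr {f g : ℝ → ℝ} (h : EqOn f g (Ioi 0)) (lam : ℝ) :
    laplace f lam = laplace g lam :=
  setIntegral_congr_fun measurableSet_Ioi fun s hs => by simp only [h hs]

namespace HasLaplace

variable {f g Φ Ψ : ℝ → ℝ}

lemma congr (hf : HasLaplace f Φ) (h : EqOn g f (Ioi 0)) (h' : Ψ =ᶠ[atTop] Φ) :
    HasLaplace g Ψ := by
  refine ⟨hf.toWeaklySingular.congr h, ?_⟩
  filter_upwards [hf.laplace_eq, h'] with lam h1 h2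
  rw [laplace_congr h, h1, h2]

lemma add (hf : HasLaplace f Φ) (hg : HasLaplace g Ψ) :
    HasLaplace (fun t => f t + g t) (fun lam => Φ lam + Ψ lam) := by
  refine ⟨hf.toWeaklySingular.add hg.toWeaklySingular, ?_⟩
  filter_upwards [hf.laplace_eq, hg.laplace_eq, hf.lapIntegrable, hg.lapIntegrable]
    with lam h1 h2 h3 h4
  rw [← h1, ← h2, laplace, laplace, laplace, ← integral_add h3 h4]
  simp only [mul_add]

lemma const_mul (c : ℝ) (hf : HasLaplace f Φ) :
    HasLaplace (fun t => c * f t) (fun lam => c * Φ lam) := by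
  refine ⟨hf.toWeaklySingular.const_mul c, ?_⟩
  filter_upwards [hf.laplace_eq] with lam h1
  rw [← h1, laplace, laplace, ← integral_const_mul]
  congr 1
  ext s
  ring

lemma sub (hf : HasLaplace f Φ) (hg : HasLaplace g Ψ) :
    HasLaplace (fun t => f t - g t) (fun lam => Φ lam - Ψ lam) :=
  (hf.add (hg.const_mul (-1))).congr (fun t _ => by ring) (Eventually.of_forall fun t => by ring)

lemma exp_mul (c : ℝ) (hf : HasLaplace f Φ) :
    HasLaplace (fun t => exp (-c * t) * f t) (fun lam => Φ (lam + c)) := by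
  refine ⟨hf.toWeaklySingular.exp_mul c, ?_⟩
  filter_upwards [(tendsto_atTop_add_const_right atTop c tendsto_id).eventually hf.laplace_eq]
    with lam h1
  rw [← id_eq lam, ← h1, laplace, laplace]
  congr 1
  ext s
  rw [← mul_assoc, ← exp_add]
  simp only [id]
  ring_nf

lemma one : HasLaplace (fun _ => 1) (fun lam => 1 / lam) := by
  refine ⟨WeaklySingular.of_bounded continuousOn_const (C := 1) (by simp), ?_⟩
  filter_upwards [eventually_gt_atTop 0] with lam hlam
  rw [laplace]
  simp only [mul_one]
  rw [integral_exp_mul_Ioi (by linarith) 0]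
  simp

lemma const (c : ℝ) : HasLaplace (fun _ => c) (fun lam => c / lam) :=
  (one.const_mul c).congr (fun t _ => by simp) (Eventually.of_forall fun t => by
    simp [div_eq_mul_inv])

lemma conv {k K : ℝ → ℝ} (hk : HasLaplace k K) (hf : HasLaplace f Φ) :
    HasLaplace (conv k f) (fun lam => K lam * Φ lam) := by
  refine ⟨hk.toWeaklySingular.conv hf.toWeaklySingular, ?_⟩
  filter_upwards [hk.laplace_eq, hf.laplace_eq, hk.lapIntegrable, hf.lapIntegrable]
    with lam h1 h2 h3 h4
  rw [laplace_conv h3 h4, h1, h2]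

lemma primitive (hf : HasLaplace f Φ) :
    HasLaplace (fun t => ∫ s in (0 : ℝ)..t, f s) (fun lam => Φ lam / lam) :=
  (one.conv hf).congr (fun t _ => by simp [LimitEq.conv]) (Eventually.of_forall fun t => by
    simp [div_eq_inv_mul])

theorem eqOn (hf : HasLaplace f Φ) (hg : HasLaplace g Ψ) (h : Φ =ᶠ[atTop] Ψ) :
    EqOn f g (Ioi 0) := by
  refine eqOn_Ioi_of_ae_eq hf.continuousOn hg.continuousOn
    (ae_eq_of_laplace_eventuallyEq hf.lapIntegrable hg.lapIntegrable ?_)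
  filter_upwards [hf.laplace_eq, hg.laplace_eq, h] with lam h1 h2 h3
  rw [h1, h2, h3]

/-- Uniqueness of the inverse transform, so that any admissible `H` may be replaced by an explicitly
constructed one. -/
theorem eqOn_of_isInverseLaplace (hf : HasLaplace f Φ) {H : ℝ → ℝ} (hH : IsInverseLaplace Φ H) :
    EqOn H f (Ioi 0) := by
  refine eqOn_Ioi_of_ae_eq hH.continuousOn hf.continuousOn
    (ae_eq_of_laplace_eventuallyEq ?_ hf.lapIntegrable ?_)
  · filter_upwards [eventually_gt_atTop 0] with lam hlam using hH.integrable lam hlam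
  · filter_upwards [hf.laplace_eq, eventually_gt_atTop 0] with lam h1 h2
    rw [h1, hH.laplace_eq lam h2]

end HasLaplace

/-! ### The complementary error function -/

lemma integrable_exp_neg_sq : Integrable fun τ : ℝ => exp (-τ ^ 2) := by
  simpa using integrable_exp_neg_mul_sq one_pos

lemma erfc_eq (s : ℝ) : erfc s = 1 - 2 / √π * ∫ τ in (0 : ℝ)..s, exp (-τ ^ 2) := by
  have h1 : ∫ τ in Ioi (0 : ℝ), exp (-τ ^ 2) = √π / 2 := by simpa using integral_gaussian_Ioi 1
  have h2 := intervalIntegral.integral_Ioi_sub_Ioi' (a := 0) (b := s)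
    integrable_exp_neg_sq.integrableOn integrable_exp_neg_sq.integrableOn
  have hpi : √π ≠ 0 := (sqrt_pos.2 pi_pos).ne'
  rw [erfc, ← h2, h1]
  field_simp
  ring

lemma hasDerivAt_erfc (s : ℝ) : HasDerivAt erfc (-(2 / √π * exp (-s ^ 2))) s := by
  have h : HasDerivAt (fun s => 1 - 2 / √π * ∫ τ in (0 : ℝ)..s, exp (-τ ^ 2))
      (-(2 / √π * exp (-s ^ 2))) s := by
    refine HasDerivAt.const_sub 1 (HasDerivAt.const_mul _ ?_)
    have hc : Continuous fun τ : ℝ => exp (-τ ^ 2) := by fun_prop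
    exact intervalIntegral.integral_hasDerivAt_right (hc.intervalIntegrable _ _)
      (hc.stronglyMeasurableAtFilter _ _) hc.continuousAt
  rwa [funext erfc_eq]

lemma continuous_erfc : Continuous erfc :=
  continuous_iff_continuousAt.2 fun s => (hasDerivAt_erfc s).continuousAt

lemma erfc_zero : erfc 0 = 1 := by simp [erfc_eq]

lemma erfc_nonneg (s : ℝ) : 0 ≤ erfc s :=
  mul_nonneg (by positivity) (integral_nonneg fun _ => (exp_pos _).le)

lemma tendsto_erfc_atTop : Tendsto erfc atTop (𝓝 0) := by
  have := (tendsto_integral_Ioi_zero (f := fun τ : ℝ => exp (-τ ^ 2)) (μ := volume) (b := id)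
    (l := atTop) tendsto_id).const_mul (2 / √π)
  have h : erfc = fun s => 2 / √π * ∫ τ in Ioi s, exp (-τ ^ 2) := rfl
  rw [h]
  simpa using this

lemma tendsto_erfc_atBot : Tendsto erfc atBot (𝓝 2) := by
  have h1 : ∫ τ in Iic (0 : ℝ), exp (-τ ^ 2) = √π / 2 := by
    have h := integral_comp_neg_Ioi (0 : ℝ) fun τ => exp (-τ ^ 2)
    simp only [even_two, Even.neg_pow, neg_zero] at h
    rw [← h]
    simpa using integral_gaussian_Ioi 1
  have h := (intervalIntegral_tendsto_integral_Iic 0 integrable_exp_neg_sq.integrableOn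
    tendsto_id).const_mul (2 / √π)
  have h2 := h.const_add 1
  rw [h1] at h2
  have hpi : √π ≠ 0 := (sqrt_pos.2 pi_pos).ne'
  convert! h2 using 1
  · ext s
    rw [erfc_eq, intervalIntegral.integral_symm]
    simp only [id]
    ring
  · congr 1
    field_simp
    norm_num

lemma erfc_le_two (s : ℝ) : erfc s ≤ 2 := by
  have ha : Antitone erfc := antitone_of_deriv_nonpos
    (fun s => (hasDerivAt_erfc s).differentiableAt) fun s => by
      rw [(hasDerivAt_erfc s).deriv, neg_nonpos]; positivity
  exact ge_of_tendsto tendsto_erfc_atBot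
    ((eventually_le_atBot s).mono fun x hx => ha hx)

/-! ### Kernels built from the half-order kernel -/

lemma fKer_half {t : ℝ} (ht : 0 < t) (α : ℝ) :
    fKer α (1 / 2) t = exp (-α * t) * (1 / √π * (1 / √t)) := by
  rw [fKer, Gamma_one_half_eq, show (1 / 2 - 1 : ℝ) = -(1 / 2) by norm_num, rpow_neg ht.le,
    ← sqrt_eq_rpow]
  ring

lemma hasLaplace_inv_sqrt : HasLaplace (fun t => 1 / √t) fun lam => √π / √lam := by
  refine ⟨⟨?_, 1, 0, zero_le_one, le_rfl, fun t _ => ?_⟩, ?_⟩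
  · exact continuousOn_const.div (by fun_prop) fun t ht => (sqrt_pos.2 ht).ne'
  · simp [abs_of_nonneg (sqrt_nonneg t)]
  · filter_upwards [eventually_gt_atTop 0] with lam hlam
    rw [← integral_exp_div_sqrt hlam, laplace]
    simp only [mul_one_div]

lemma hasLaplace_fKer (α : ℝ) :
    HasLaplace (fKer α (1 / 2)) fun lam => 1 / √(lam + α) := by
  refine ((hasLaplace_inv_sqrt.const_mul (1 / √π)).exp_mul α).congr
    (fun t ht => fKer_half ht α) (Eventually.of_forall fun lam => ?_)
  have hpi : √π ≠ 0 := (sqrt_pos.2 pi_pos).ne'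
  simp only
  field_simp

lemma WeaklySingular.hasLaplace {f : ℝ → ℝ} (hf : WeaklySingular f) : HasLaplace f (laplace f) :=
  ⟨hf, Eventually.of_forall fun _ => rfl⟩

/-- The function `e^{μ² t} erfc(μ √t)`. -/
noncomputable def expErfc (μ t : ℝ) : ℝ := exp (μ ^ 2 * t) * erfc (μ * √t)

lemma continuous_expErfc (μ : ℝ) : Continuous (expErfc μ) :=
  (by fun_prop : Continuous fun t : ℝ => exp (μ ^ 2 * t)).mul
    (continuous_erfc.comp (by fun_prop))

lemma weaklySingular_expErfc (μ : ℝ) : WeaklySingular (expErfc μ) := by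
  refine WeaklySingular.of_exp_bound (C := 2) (κ := μ ^ 2) (continuous_expErfc μ).continuousOn
    (sq_nonneg μ) fun t _ => ?_
  rw [expErfc, abs_mul, abs_exp, abs_of_nonneg (erfc_nonneg _), mul_comm]
  exact mul_le_mul_of_nonneg_right (erfc_le_two _) (exp_pos _).le

lemma hasDerivAt_expErfc (μ : ℝ) {t : ℝ} (ht : 0 < t) :
    HasDerivAt (expErfc μ) (μ ^ 2 * expErfc μ t - μ * fKer 0 (1 / 2) t) t := by
  have h1 : HasDerivAt (fun t => exp (μ ^ 2 * t)) (exp (μ ^ 2 * t) * (μ ^ 2 * 1)) t :=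
    ((hasDerivAt_id t).const_mul (μ ^ 2)).exp
  have h2 : HasDerivAt (fun t => erfc (μ * √t))
      (-(2 / √π * exp (-(μ * √t) ^ 2)) * (μ * (1 / (2 * √t)))) t :=
    (hasDerivAt_erfc _).comp t ((hasDerivAt_sqrt ht.ne').const_mul μ)
  convert! h1.mul h2 using 1
  have h3 : exp (μ ^ 2 * t) * exp (-(μ * √t) ^ 2) = 1 := by
    rw [← exp_add, mul_pow, sq_sqrt ht.le]; simp
  rw [fKer_half ht, expErfc]
  simp only [neg_zero, zero_mul, exp_zero, one_mul]
  linear_combination (μ * (1 / √π * (1 / √t))) * h3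

lemma expErfc_eq (μ : ℝ) {t : ℝ} (ht : 0 < t) : expErfc μ t =
    1 + ∫ s in (0 : ℝ)..t, (μ ^ 2 * expErfc μ s - μ * fKer 0 (1 / 2) s) := by
  rw [intervalIntegral.integral_eq_sub_of_hasDerivAt_of_le ht.le (f := expErfc μ)
    (continuous_expErfc μ).continuousOn (fun s hs => hasDerivAt_expErfc μ hs.1)]
  · simp [expErfc, erfc_zero]
  · exact (((weaklySingular_expErfc μ).hasLaplace.const_mul _).sub
      ((hasLaplace_fKer 0).const_mul μ)).intervalIntegrable t ht.le

/-- Transforming the integrated differential equation `expErfc_eq` gives a linear equation for the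
transform. With x = √λ it carries a factor x - μ, nonzero because only λ > μ² is considered. -/
lemma hasLaplace_expErfc {μ : ℝ} (hμ : 0 ≤ μ) :
    HasLaplace (expErfc μ) fun lam => 1 / (√lam * (√lam + μ)) := by
  refine ⟨weaklySingular_expErfc μ, ?_⟩
  have h : HasLaplace (expErfc μ) _ := (HasLaplace.one.add (((weaklySingular_expErfc μ).hasLaplace.const_mul (μ ^ 2)).sub
      ((hasLaplace_fKer 0).const_mul μ)).primitive).congr
      (fun t ht => expErfc_eq μ ht) EventuallyEq.rfl
  filter_upwards [h.laplace_eq, eventually_gt_atTop (μ ^ 2)] with lam h1 h2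
  simp only [add_zero] at h1
  have hl : 0 < lam := (sq_nonneg μ).trans_lt h2
  obtain ⟨x, hx, rfl⟩ : ∃ x, 0 < x ∧ lam = x ^ 2 := ⟨√lam, sqrt_pos.2 hl, (sq_sqrt hl.le).symm⟩
  rw [sqrt_sq hx.le] at h1 ⊢
  have h3 : μ < x := lt_of_pow_lt_pow_left₀ 2 hx.le h2
  have hne : x - μ ≠ 0 := by linarith
  have hne' : x + μ ≠ 0 := by positivity
  field_simp at h1 ⊢
  have : (x - μ) * (laplace (expErfc μ) (x ^ 2) * x * (x + μ) - 1) = 0 := by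
    linear_combination h1
  linarith [(mul_eq_zero.1 this).resolve_left hne]

lemma qKer_eq (μ t : ℝ) : qKer μ t = fKer 0 (1 / 2) t - μ * expErfc μ t := by
  rw [qKer, expErfc, mul_assoc]

lemma hasLaplace_qKer {μ : ℝ} (hμ : 0 ≤ μ) : HasLaplace (qKer μ) fun lam => 1 / (√lam + μ) := by
  refine ((hasLaplace_fKer 0).sub ((hasLaplace_expErfc hμ).const_mul μ)).congr
    (fun t _ => qKer_eq μ t) ?_
  filter_upwards [eventually_gt_atTop 0] with lam hlam
  have hx : 0 < √lam := sqrt_pos.2 hlam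
  rw [add_zero]
  field_simp
  ring

/-- The first two terms combine through 1/κ + a²/(λκ) = κ/λ, where κ² = λ + a². -/
lemma hasLaplace_mKer (a : ℝ) :
    HasLaplace (mKer a) fun lam => 2 * (√(lam + a ^ 2) - a) / lam := by
  refine ((((hasLaplace_fKer (a ^ 2)).add ((hasLaplace_fKer (a ^ 2)).primitive.const_mul
    (a ^ 2))).sub (HasLaplace.const a)).const_mul 2).congr (fun t _ => rfl) ?_
  filter_upwards [eventually_gt_atTop 0] with lam hlam
  have hp : 0 < lam + a ^ 2 := by positivity
  have hx : 0 < √(lam + a ^ 2) := sqrt_pos.2 hp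
  have h := sq_sqrt hp.le
  field_simp
  linear_combination h

/-- The transform is written as that of m_a·(-c) minus 2κ g^a for the exponential datum, the form in
which the source enters the general equation. Each erfc term is e^{-a²t} times an `expErfc`. -/
lemma hasLaplace_expSource (a c : ℝ) {μ : ℝ} (ha : 0 ≤ a) (hμ : 0 ≤ μ) :
    HasLaplace (expSource a c μ) fun lam =>
      2 * (√(lam + a ^ 2) - a) / lam * (-c) + 2 * c / (√(lam + a ^ 2) + μ) := by
  refine ((((hasLaplace_expErfc ha).exp_mul (a ^ 2)).const_mul (2 * c * a)).sub
    (((hasLaplace_expErfc hμ).exp_mul (a ^ 2)).const_mul (2 * c * μ))).congr (fun t _ => ?_) ?_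
  · have h1 : exp (-a ^ 2 * t) * exp (a ^ 2 * t) = 1 := by rw [← exp_add]; simp
    have h2 : exp ((μ ^ 2 - a ^ 2) * t) = exp (-a ^ 2 * t) * exp (μ ^ 2 * t) := by
      rw [← exp_add]; ring_nf
    simp only [expSource, expErfc, h2]
    linear_combination (-(2 * c * a * erfc (a * √t))) * h1
  · filter_upwards [eventually_gt_atTop 0] with lam hlam
    have hp : 0 < lam + a ^ 2 := by positivity
    have hx : 0 < √(lam + a ^ 2) := sqrt_pos.2 hp
    have h : lam = √(lam + a ^ 2) ^ 2 - a ^ 2 := by rw [sq_sqrt hp.le]; ring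
    set x := √(lam + a ^ 2)
    have hxa : x - a ≠ 0 := by
      intro h0
      have : x = a := by linarith
      rw [this] at h
      simp at h
      exact hlam.ne' h
    have hl : lam = (x - a) * (x + a) := by rw [h]; ring
    rw [hl]
    have hxa' : x + a ≠ 0 := by positivity
    have hxm : x + μ ≠ 0 := by positivity
    field_simp
    ring

/-! ### The memory equation for primitives of weakly singular functions -/

lemma deriv_energy (a b ζ : ℝ) : deriv (energy a b) ζ = 2 * b * ζ + 2 * a * (ζ - 1) := by
  have h1 : HasDerivAt (fun ζ : ℝ => b * ζ ^ 2) (b * (2 * ζ)) ζ := by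
    simpa using (hasDerivAt_pow 2 ζ).const_mul b
  have h2 : HasDerivAt (fun ζ : ℝ => a * (ζ - 1) ^ 2) (a * (2 * (ζ - 1))) ζ := by
    simpa using (((hasDerivAt_id ζ).sub_const 1).pow 2).const_mul a
  have : HasDerivAt (energy a b) _ ζ := h1.add h2
  rw [this.deriv]
  ring

lemma WeaklySingular.hasDerivAt_primitive {D : ℝ → ℝ} (hD : WeaklySingular D) (c : ℝ) {t : ℝ}
    (ht : 0 < t) : HasDerivAt (fun t => c + ∫ s in (0 : ℝ)..t, D s) (D t) t :=
  (intervalIntegral.integral_hasDerivAt_right (hD.intervalIntegrable t ht.le)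
    (hD.continuousOn.stronglyMeasurableAtFilter isOpen_Ioi t ht)
    (hD.continuousOn.continuousAt (Ioi_mem_nhds ht))).const_add c

lemma WeaklySingular.continuousOn_primitive {D : ℝ → ℝ} (hD : WeaklySingular D) (c : ℝ) :
    ContinuousOn (fun t => c + ∫ s in (0 : ℝ)..t, D s) (Ici 0) := by
  refine continuousOn_const.add fun t ht => ?_
  have ht' : (0 : ℝ) ≤ t := ht
  have h := intervalIntegral.continuousOn_primitive_interval'
    (hD.intervalIntegrable (t + 1) (by positivity)) (left_mem_uIcc)
  rw [uIcc_of_le (by positivity)] at h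
  refine (h t ⟨ht', by linarith⟩).mono_of_mem_nhdsWithin ?_
  rw [← Ici_inter_Iic]
  exact inter_mem_nhdsWithin _ (Iic_mem_nhds (by linarith))

lemma SolvesMemoryEq.congr {a b : ℝ} {R R' ξ ξ' : ℝ → ℝ} (h : SolvesMemoryEq a b R ξ)
    (hR : EqOn R' R (Ioi 0)) (hξ : EqOn ξ' ξ (Ici 0)) : SolvesMemoryEq a b R' ξ' := by
  have hev : ∀ t > 0, ξ' =ᶠ[𝓝 t] ξ := fun t ht => by
    filter_upwards [Ioi_mem_nhds ht] with s hs using hξ (mem_Ici.2 (mem_Ioi.1 hs).le)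
  have hd : ∀ t > 0, deriv ξ' t = deriv ξ t := fun t ht => (hev t ht).deriv_eq
  refine ⟨h.continuousOn.congr hξ, fun t ht => (h.differentiableAt t ht).congr_of_eventuallyEq
    (hev t ht), fun T hT => ?_, fun t ht => ?_, fun t ht => ?_⟩
  · refine IntervalIntegrable.congr (fun s hs => ?_) (h.deriv_integrable T hT)
    rw [uIoc_of_le hT.le] at hs
    exact (hd s hs.1).symm
  · refine IntervalIntegrable.congr (fun s hs => ?_) (h.memory_integrable t ht)
    rw [uIoc_of_le (le_of_lt ht)] at hs
    simp only [hd s hs.1]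
  · rw [hR ht, hξ (mem_Ici.2 (le_of_lt ht)), ← h.equation t ht, memOp, memOp]
    congr 1
    refine intervalIntegral.integral_congr_ae (Eventually.of_forall fun s hs => ?_)
    rw [uIoc_of_le (le_of_lt ht)] at hs
    rw [hd s hs.1]

/-- Both sides of the memory equation are weakly singular, hence continuous on (0,∞), so equality of
transforms gives it at every t > 0. The transform of ξ is (ξ₀ + Φ)/λ. -/
lemma solvesMemoryEq_primitive {a b ξ₀ : ℝ} {D R Φ Ρ : ℝ → ℝ} (hD : HasLaplace D Φ)
    (hR : HasLaplace R Ρ)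
    (h : ∀ᶠ lam in atTop, 2 * (√(lam + a ^ 2) - a) / lam * Φ lam + Ρ lam =
      -(2 * b * ((ξ₀ + Φ lam) / lam) + 2 * a * ((ξ₀ + Φ lam) / lam - 1 / lam))) :
    SolvesMemoryEq a b R (fun t => ξ₀ + ∫ s in (0 : ℝ)..t, D s) := by
  have hd : ∀ t > 0, deriv (fun t => ξ₀ + ∫ s in (0 : ℝ)..t, D s) t = D t := fun t ht =>
    (hD.hasDerivAt_primitive ξ₀ ht).deriv
  have hm := hasLaplace_mKer a
  refine ⟨hD.continuousOn_primitive ξ₀,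
    fun t ht => (hD.hasDerivAt_primitive ξ₀ ht).differentiableAt, fun T hT => ?_, fun t ht => ?_, ?_⟩
  · refine IntervalIntegrable.congr (fun s hs => ?_) (hD.intervalIntegrable T hT.le)
    rw [uIoc_of_le hT.le] at hs
    exact (hd s hs.1).symm
  · refine IntervalIntegrable.congr (fun s hs => ?_)
      (hm.conv_intervalIntegrable hD.toWeaklySingular ht)
    rw [uIoc_of_le (le_of_lt ht)] at hs
    simp only [hd s hs.1]
  · have hξ : HasLaplace (fun t => ξ₀ + ∫ s in (0 : ℝ)..t, D s) _ :=
      (HasLaplace.const ξ₀).add hD.primitive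
    have key := ((hm.conv hD).add hR).eqOn
      (((hξ.const_mul (2 * b)).add ((hξ.sub HasLaplace.one).const_mul (2 * a))).const_mul (-1)) ?_
    · intro t ht
      rw [deriv_energy]
      have h1 := key ht
      simp only at h1
      have h2 : memOp a (deriv fun t => ξ₀ + ∫ s in (0 : ℝ)..t, D s) t = conv (mKer a) D t := by
        refine intervalIntegral.integral_congr_ae (Eventually.of_forall fun s hs => ?_)
        rw [uIoc_of_le (le_of_lt ht)] at hs
        rw [hd s hs.1]
      rw [h2, h1]
      ring
    · filter_upwards [h] with lam h1
      rw [h1]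
      ring

/-! ### Uniqueness for the memory equation -/

/-- The L¹ norm of e^{-λs}k is O((λ - κ)^{-1/2}); this smallness is what makes the Volterra operator
a contraction in a weighted norm. -/
lemma WeaklySingular.eventually_laplace_abs_le {k : ℝ → ℝ} (hk : WeaklySingular k) {ε : ℝ}
    (hε : 0 < ε) : ∀ᶠ lam in atTop, LapIntegrable k lam ∧
      ∫ s in Ioi (0 : ℝ), |exp (-lam * s) * k s| ≤ ε := by
  obtain ⟨C, κ, hC, hκ, hb⟩ := hk.bound
  have hlim : Tendsto (fun lam => C * (√π / √(lam - κ))) atTop (𝓝 (C * 0)) := by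
    refine Tendsto.const_mul C (Tendsto.div_atTop tendsto_const_nhds ?_)
    exact tendsto_sqrt_atTop.comp (tendsto_atTop_add_const_right atTop (-κ) tendsto_id)
  rw [mul_zero] at hlim
  filter_upwards [hk.lapIntegrable, eventually_gt_atTop κ,
    hlim.eventually (eventually_le_nhds hε)] with lam h1 h2 h3
  refine ⟨h1, le_trans ?_ h3⟩
  have hp : 0 < lam - κ := sub_pos.2 h2
  rw [← integral_exp_div_sqrt hp, ← integral_const_mul]
  refine setIntegral_mono_on h1.abs ((integrableOn_exp_div_sqrt hp).const_mul C) measurableSet_Ioi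
    fun t ht => ?_
  rw [abs_mul, abs_exp]
  calc exp (-lam * t) * |k t| ≤ exp (-lam * t) * (C * (exp (κ * t) / √t)) := by
        gcongr; exact hb t ht
    _ = C * (exp (-(lam - κ) * t) / √t) := by
        rw [show -(lam - κ) * t = -lam * t + κ * t by ring, exp_add]; ring

/-- Let M be the maximum of e^{-Lt}|y(t)|, with L so large that e^{-Ls}k has L¹ norm at most 1/2.
The equation at the maximum point yields M ≤ M/2. -/
lemma eq_zero_of_eq_conv {k y : ℝ → ℝ} (hk : WeaklySingular k) {T : ℝ} (hT : 0 ≤ T)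
    (hy : ContinuousOn y (Icc 0 T)) (h0 : y 0 = 0) (h : ∀ t ∈ Ioc 0 T, y t = conv k y t) :
    ∀ t ∈ Icc 0 T, y t = 0 := by
  obtain ⟨L, hL, hL2⟩ := (hk.eventually_laplace_abs_le (ε := 1 / 2) (by norm_num)).exists
  have hc : ContinuousOn (fun t => exp (-L * t) * |y t|) (Icc 0 T) :=
    (Continuous.continuousOn (by fun_prop)).mul hy.abs
  obtain ⟨x, hx, hmax⟩ := isCompact_Icc.exists_isMaxOn (nonempty_Icc.2 hT) hc
  set M := exp (-L * x) * |y x| with hM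
  have hM0 : 0 ≤ M := by positivity
  have hbound : ∀ s ∈ Icc 0 T, exp (-L * s) * |y s| ≤ M := fun s hs => hmax hs
  have hMle : M ≤ 1 / 2 * M := by
    rcases eq_or_lt_of_le hx.1 with hx0 | hx0
    · rw [hM, ← hx0, h0]; simp
    have hle : |exp (-L * x) * conv k y x| ≤
        ∫ s in (0 : ℝ)..x, |exp (-L * (x - s)) * k (x - s)| * M := by
      rw [exp_mul_conv, ← norm_eq_abs]
      refine intervalIntegral.norm_integral_le_of_norm_le hx0.le
        (Eventually.of_forall fun s hs => ?_) ?_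
      · rw [ContinuousLinearMap.mul_apply', norm_mul, mul_comm, norm_eq_abs, norm_eq_abs]
        refine mul_le_mul_of_nonneg_left ?_ (abs_nonneg _)
        rw [abs_mul, abs_exp]
        exact hbound s ⟨hs.1.le, hs.2.trans hx.2⟩
      · refine IntervalIntegrable.mul_const ?_ M
        have h1 : IntervalIntegrable (fun s => |exp (-L * s) * k s|) volume 0 x := by
          rw [intervalIntegrable_iff_integrableOn_Ioc_of_le hx0.le]
          exact IntegrableOn.mono_set hL.abs Ioc_subset_Ioi_self
        have := (h1.comp_sub_left x).symm
        simpa using this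
    have heq : ∫ s in (0 : ℝ)..x, |exp (-L * (x - s)) * k (x - s)| * M ≤ 1 / 2 * M := by
      rw [intervalIntegral.integral_mul_const]
      refine mul_le_mul_of_nonneg_right (le_trans ?_ hL2) hM0
      rw [intervalIntegral.integral_comp_sub_left (fun s => |exp (-L * s) * k s|) x, sub_self,
        sub_zero, intervalIntegral.integral_of_le hx0.le]
      exact setIntegral_mono_set hL.abs (Eventually.of_forall fun _ => abs_nonneg _)
        Ioc_subset_Ioi_self.eventuallyLE
    rw [hM]
    rw [← h x ⟨hx0, hx.2⟩, abs_mul, abs_exp] at hle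
    exact hle.trans heq
  have hM00 : M = 0 := by linarith
  intro t ht
  have := hbound t ht
  rw [hM00] at this
  have h2 : |y t| ≤ 0 := nonpos_of_mul_nonpos_right this (exp_pos _)
  exact abs_nonpos_iff.1 h2

lemma hasLaplace_resolvent (a : ℝ) : HasLaplace
    (fun t => 1 / 2 * (fKer (a ^ 2) (1 / 2) t +
      a ^ 2 * (∫ s in (0 : ℝ)..t, fKer (a ^ 2) (1 / 2) s) + a))
    fun lam => (√(lam + a ^ 2) + a) / (2 * lam) := by
  refine ((((hasLaplace_fKer (a ^ 2)).add ((hasLaplace_fKer (a ^ 2)).primitive.const_mul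
    (a ^ 2))).add (HasLaplace.const a)).const_mul (1 / 2)).congr (fun t _ => rfl) ?_
  filter_upwards [eventually_gt_atTop 0] with lam hlam
  have hp : 0 < lam + a ^ 2 := by positivity
  have hx : 0 < √(lam + a ^ 2) := sqrt_pos.2 hp
  have h := sq_sqrt hp.le
  field_simp
  linear_combination h

/-- The kernel inverts m_a up to one integration: (κ + a)/(2λ) · 2(κ - a)/λ = (κ² - a²)/λ² = 1/λ. -/
lemma exists_resolvent (a : ℝ) : ∃ k K : ℝ → ℝ, HasLaplace k K ∧
    ∀ᶠ lam in atTop, K lam * (2 * (√(lam + a ^ 2) - a) / lam) = 1 / lam := by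
  refine ⟨_, _, hasLaplace_resolvent a, ?_⟩
  filter_upwards [eventually_gt_atTop 0] with lam hlam
  have hp : 0 < lam + a ^ 2 := by positivity
  have h := sq_sqrt hp.le
  field_simp
  linear_combination h

/-- Deconvolution: `d` with convolution `m_a * d` is recovered from `k * (m_a * d) = 1 * d`. -/
lemma conv_resolvent_ae {a : ℝ} {k K : ℝ → ℝ} (hk : HasLaplace k K)
    (hK : ∀ᶠ lam in atTop, K lam * (2 * (√(lam + a ^ 2) - a) / lam) = 1 / lam) {d : ℝ → ℝ}
    (hd : ∀ᶠ lam in atTop, LapIntegrable d lam) :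
    ∀ᵐ t : ℝ, t ∈ Ioi (0 : ℝ) → conv k (conv (mKer a) d) t = conv (fun _ => 1) d t := by
  have hm := hasLaplace_mKer a
  -- `d` will be the derivative of an arbitrary solution, merely integrable, so its convolutions are
  -- not known to be continuous and only almost everywhere equality is available here.
  refine ae_eq_of_laplace_eventuallyEq ?_ ?_ ?_
  · filter_upwards [hk.lapIntegrable, hm.lapIntegrable, hd] with lam h1 h2 h3
    exact h1.conv (h2.conv h3)
  · filter_upwards [HasLaplace.one.lapIntegrable, hd] with lam h1 h2 using h1.conv h2
  · filter_upwards [hk.lapIntegrable, hm.lapIntegrable, hd, HasLaplace.one.lapIntegrable,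
      hk.laplace_eq, hm.laplace_eq, HasLaplace.one.laplace_eq, hK] with lam h1 h2 h3 h4 h5 h6 h7 h8
    rw [laplace_conv h1 (h2.conv h3), laplace_conv h2 h3, laplace_conv h4 h3, h5, h6, h7, ← h8]
    ring

/-- Solutions carry no growth condition at infinity, so the derivative of the difference is cut off
at S and the difference itself is frozen beyond S; causality of convolution makes both changes
invisible on (0,S]. -/
theorem SolvesMemoryEq.unique {a b : ℝ} {R ξ₁ ξ₂ : ℝ → ℝ} (h₁ : SolvesMemoryEq a b R ξ₁)
    (h₂ : SolvesMemoryEq a b R ξ₂) (h0 : ξ₁ 0 = ξ₂ 0) : EqOn ξ₁ ξ₂ (Ici 0) := by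
  intro T hT0
  have hT : (0 : ℝ) ≤ T := hT0
  obtain ⟨k, K, hk, hK⟩ := exists_resolvent a
  set y : ℝ → ℝ := fun t => ξ₁ t - ξ₂ t with hy
  have hyc : ContinuousOn y (Ici 0) := h₁.continuousOn.sub h₂.continuousOn
  -- Any S > T would do: T must lie inside the open interval on which almost everywhere equality of
  -- continuous functions is upgraded.
  set S := T + 1 with hS
  have hS0 : 0 < S := by positivity
  set d₀ : ℝ → ℝ := fun s => deriv ξ₁ s - deriv ξ₂ s with hd₀
  have hd₀i : ∀ t > 0, IntervalIntegrable d₀ volume 0 t := fun t ht =>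
    (h₁.deriv_integrable t ht).sub (h₂.deriv_integrable t ht)
  set d : ℝ → ℝ := (Ioc 0 S).indicator d₀ with hd
  have hdint : Integrable d := by
    rw [hd, integrable_indicator_iff measurableSet_Ioc]
    exact (intervalIntegrable_iff_integrableOn_Ioc_of_le hS0.le).1 (hd₀i S hS0)
  have hdl : ∀ᶠ lam in atTop, LapIntegrable d lam := by
    filter_upwards [eventually_ge_atTop 0] with lam hlam
    refine hdint.integrableOn.bdd_mul (c := 1) (by fun_prop) ?_
    filter_upwards [ae_restrict_mem measurableSet_Ioi] with s hs
    rw [norm_of_nonneg (exp_pos _).le, exp_le_one_iff]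
    have : (0 : ℝ) < s := hs
    nlinarith
  have hdconv : ∀ (m : ℝ → ℝ), ∀ t ∈ Ioc 0 S, conv m d t = conv m d₀ t := by
    intro m t ht
    refine intervalIntegral.integral_congr_ae (Eventually.of_forall fun s hs => ?_)
    rw [uIoc_of_le ht.1.le] at hs
    rw [hd, indicator_of_mem (mem_Ioc.2 ⟨hs.1, hs.2.trans ht.2⟩)]
  have h1d : ∀ t ∈ Ioc 0 S, conv (fun _ => 1) d t = y t := by
    intro t ht
    rw [hdconv _ t ht, conv]
    simp only [one_mul]
    rw [intervalIntegral.integral_eq_sub_of_hasDerivAt_of_le ht.1.le (f := y)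
      (hyc.mono Icc_subset_Ici_self) (fun s hs => ?_) (hd₀i t ht.1)]
    · simp [hy, h0]
    · exact (h₁.differentiableAt s hs.1).hasDerivAt.sub (h₂.differentiableAt s hs.1).hasDerivAt
  have hmd : ∀ t ∈ Ioc 0 S, conv (mKer a) d t = -(2 * (a + b)) * y t := by
    intro t ht
    rw [hdconv _ t ht, conv]
    have e1 := h₁.equation t ht.1
    have e2 := h₂.equation t ht.1
    have e3 := intervalIntegral.integral_sub (h₁.memory_integrable t ht.1)
      (h₂.memory_integrable t ht.1)
    rw [memOp, deriv_energy] at e1 e2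
    simp only [← mul_sub] at e3
    rw [e3]
    simp only [hy]
    linear_combination e1 - e2
  -- the Volterra equation, first almost everywhere and then everywhere
  have hy' : WeaklySingular fun t => y (min t S) := by
    have hc : ContinuousOn (fun t => y (min t S)) (Ioi 0) := by
      refine hyc.comp (by fun_prop) fun t ht => ?_
      exact le_min (mem_Ioi.1 ht).le hS0.le
    obtain ⟨C, hC⟩ := isCompact_Icc.exists_bound_of_continuousOn
      (hyc.mono (fun t ht => ht.1 : Icc 0 S ⊆ Ici 0))
    exact WeaklySingular.of_bounded hc (C := C) fun t ht =>
      hC _ ⟨le_min (le_of_lt ht) hS0.le, min_le_right _ _⟩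
  have hk' : WeaklySingular fun t => -(2 * (a + b)) * k t := hk.toWeaklySingular.const_mul _
  have hcongr : ∀ t ∈ Ioc 0 S, conv k (conv (mKer a) d) t =
      conv (fun t => -(2 * (a + b)) * k t) (fun t => y (min t S)) t := by
    intro t ht
    refine intervalIntegral.integral_congr_ae (Eventually.of_forall fun s hs => ?_)
    rw [uIoc_of_le ht.1.le] at hs
    simp only
    rw [hmd s ⟨hs.1, hs.2.trans ht.2⟩, min_eq_left (hs.2.trans ht.2)]
    ring
  have hae : ∀ᵐ t ∂volume.restrict (Ioo 0 S), y t =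
      conv (fun t => -(2 * (a + b)) * k t) (fun t => y (min t S)) t := by
    rw [ae_restrict_iff' measurableSet_Ioo]
    filter_upwards [conv_resolvent_ae hk hK hdl] with t ht ht'
    rw [← hcongr t ⟨ht'.1, ht'.2.le⟩, ht ht'.1, h1d t ⟨ht'.1, ht'.2.le⟩]
  have hvol : EqOn y (conv (fun t => -(2 * (a + b)) * k t) (fun t => y (min t S))) (Ioo 0 S) :=
    Measure.eqOn_open_of_ae_eq hae isOpen_Ioo (hyc.mono fun t ht => ht.1.le)
      ((hk'.conv hy').continuousOn.mono fun t ht => ht.1)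
  have := eq_zero_of_eq_conv hk' hT (y := y) (hyc.mono Icc_subset_Ici_self) (by simp [hy, h0])
    (fun t ht => ?_) T ⟨hT, le_rfl⟩
  · exact sub_eq_zero.1 this
  · have hlt : t < S := lt_of_le_of_lt ht.2 (by linarith)
    rw [hvol ⟨ht.1, hlt⟩]
    refine intervalIntegral.integral_congr_ae (Eventually.of_forall fun s hs => ?_)
    rw [uIoc_of_le ht.1.le] at hs
    simp only
    rw [min_eq_left (hs.2.trans hlt.le)]

/-! ### Construction of the solution from the free heat flow -/

/-- If r + ∫U is the free flow at the origin, its damped version e^{-a²t}(r + ∫U) has derivative F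
with transform λΓ(λ + a²) - r. The factor κ/(κ + b) = 1 - b/(κ + b) is then realised by convolution
with e^{-a²t} q^b. -/
lemma exists_solution_derivative {a b r : ℝ} (hb : 0 < b) {U Γ : ℝ → ℝ}
    (hU : HasLaplace U fun p => p * Γ p - r) : ∃ D, HasLaplace D fun lam =>
      √(lam + a ^ 2) / (√(lam + a ^ 2) + b) * (lam * Γ (lam + a ^ 2) - r)
        - b * (1 + r) / (√(lam + a ^ 2) + b) := by
  have hF : HasLaplace (fun t => exp (-a ^ 2 * t) * (U t - a ^ 2 * (r + ∫ s in (0 : ℝ)..t, U s)))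
      fun lam => lam * Γ (lam + a ^ 2) - r := by
    refine ((hU.sub (((HasLaplace.const r).add hU.primitive).const_mul (a ^ 2))).exp_mul
      (a ^ 2)).congr (fun t _ => rfl) ?_
    filter_upwards [eventually_gt_atTop 0] with lam hlam
    have hp : lam + a ^ 2 ≠ 0 := by positivity
    field_simp
    ring
  have hq := (hasLaplace_qKer hb.le).exp_mul (a ^ 2)
  refine ⟨_, ((hF.sub (hq.const_mul (b * (1 + r)))).sub ((hq.conv hF).const_mul b)).congr
    (fun t _ => rfl) (Eventually.of_forall fun lam => ?_)⟩
  have hx : √(lam + a ^ 2) + b ≠ 0 := by positivity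
  simp only
  field_simp
  ring

/-! ### Laplace transforms of the heat kernel and its derivatives -/

lemma integrableOn_Ioi_zero_of_tendsto {f f' : ℝ → ℝ} {m l : ℝ}
    (hderiv : ∀ t > 0, HasDerivAt f (f' t) t) (hnn : ∀ t > 0, 0 ≤ f' t)
    (h0 : Tendsto f (𝓝[>] 0) (𝓝 m)) (hinf : Tendsto f atTop (𝓝 l)) :
    IntegrableOn f' (Ioi 0) := by
  -- The value at 0 is replaced by the limit, since division by √0 gives f an unrelated default
  -- value there.
  refine integrableOn_Ioi_deriv_of_nonneg (g := Function.update f 0 m) (l := l) ?_ ?_ hnn ?_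
  · rw [continuousWithinAt_update_same, Ici_sdiff_left]
    exact h0
  · intro t ht
    refine (hderiv t ht).congr_of_eventuallyEq ?_
    filter_upwards [Ioi_mem_nhds (mem_Ioi.1 ht)] with s hs
    rw [Function.update_of_ne (mem_Ioi.1 hs).ne']
  · refine hinf.congr' ?_
    filter_upwards [eventually_gt_atTop 0] with s hs
    rw [Function.update_of_ne hs.ne']

lemma integral_Ioi_zero_of_tendsto {f f' : ℝ → ℝ} {m l : ℝ}
    (hderiv : ∀ t > 0, HasDerivAt f (f' t) t) (hint : IntegrableOn f' (Ioi 0))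
    (h0 : Tendsto f (𝓝[>] 0) (𝓝 m)) (hinf : Tendsto f atTop (𝓝 l)) :
    ∫ t in Ioi (0 : ℝ), f' t = l - m := by
  have := integral_Ioi_of_hasDerivAt_of_tendsto (f := Function.update f 0 m) (f' := f')
    (a := 0) (m := l) ?_ ?_ hint ?_
  · simpa using this
  · rw [continuousWithinAt_update_same, Ici_sdiff_left]
    exact h0
  · intro t ht
    refine (hderiv t ht).congr_of_eventuallyEq ?_
    filter_upwards [Ioi_mem_nhds (mem_Ioi.1 ht)] with s hs
    rw [Function.update_of_ne (mem_Ioi.1 hs).ne']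
  · refine hinf.congr' ?_
    filter_upwards [eventually_gt_atTop 0] with s hs
    rw [Function.update_of_ne hs.ne']

/-- The antiderivatives `e^{σxw} erfc(x√t + σw/(2√t))`, `σ = ±1`, of Gaussian-exponential kernels. -/
noncomputable def gaussPrim (x w t : ℝ) : ℝ := exp (x * w) * erfc (x * √t + w / (2 * √t))

/-- Completing the square: (x√t + w/(2√t))² - xw = x²t + w²/(4t) does not depend on the sign of w.
Hence the sum over ±w isolates the weight t^{-1/2} and the difference isolates t^{-3/2}. -/
lemma hasDerivAt_gaussPrim (x w : ℝ) {t : ℝ} (ht : 0 < t) : HasDerivAt (gaussPrim x w)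
    (-(2 / √π) * (exp (-x ^ 2 * t) * exp (-(w ^ 2 / (4 * t)))) *
      (x / (2 * √t) - w / (4 * (t * √t)))) t := by
  have hs : 0 < √t := sqrt_pos.2 ht
  have hss : √t ^ 2 = t := sq_sqrt ht.le
  have h1 : HasDerivAt (fun t => x * √t + w / (2 * √t))
      (x * (1 / (2 * √t)) + (0 * (2 * √t) - w * (2 * (1 / (2 * √t)))) / (2 * √t) ^ 2) t :=
    ((hasDerivAt_sqrt ht.ne').const_mul x).add
      ((hasDerivAt_const t w).div ((hasDerivAt_sqrt ht.ne').const_mul 2) (by positivity))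
  have h2 : HasDerivAt (gaussPrim x w) _ t :=
    ((hasDerivAt_erfc _).comp t h1).const_mul (exp (x * w))
  convert! h2 using 1
  have h3 : exp (-x ^ 2 * t) * exp (-(w ^ 2 / (4 * t)))
      = exp (x * w) * exp (-(x * √t + w / (2 * √t)) ^ 2) := by
    rw [← exp_add, ← exp_add]
    congr 1
    field_simp
    rw [hss]
    ring
  rw [h3]
  have h4 : x * (1 / (2 * √t)) + (0 * (2 * √t) - w * (2 * (1 / (2 * √t)))) / (2 * √t) ^ 2
      = x / (2 * √t) - w / (4 * (t * √t)) := by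
    rw [mul_pow, hss]
    field_simp
    ring
  rw [h4]
  ring

lemma tendsto_inv_sqrt_nhdsGT : Tendsto (fun t : ℝ => (√t)⁻¹) (𝓝[>] 0) atTop := by
  refine tendsto_inv_nhdsGT_zero.comp ?_
  rw [tendsto_nhdsWithin_iff]
  refine ⟨?_, ?_⟩
  · have : Tendsto (fun t : ℝ => √t) (𝓝 0) (𝓝 0) := by
      simpa using (continuous_sqrt.tendsto 0)
    exact this.mono_left nhdsWithin_le_nhds
  · filter_upwards [self_mem_nhdsWithin] with t ht using sqrt_pos.2 ht

lemma tendsto_sqrt_nhdsGT : Tendsto (fun t : ℝ => √t) (𝓝[>] 0) (𝓝 0) := by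
  have : Tendsto (fun t : ℝ => √t) (𝓝 0) (𝓝 0) := by
    simpa using (continuous_sqrt.tendsto 0)
  exact this.mono_left nhdsWithin_le_nhds

lemma tendsto_gaussPrim_atTop {x : ℝ} (hx : 0 < x) (w : ℝ) :
    Tendsto (gaussPrim x w) atTop (𝓝 0) := by
  have h1 : Tendsto (fun t => x * √t) atTop atTop :=
    tendsto_sqrt_atTop.const_mul_atTop hx
  have h2 : Tendsto (fun t => w / (2 * √t)) atTop (𝓝 0) :=
    tendsto_const_nhds.div_atTop (tendsto_sqrt_atTop.const_mul_atTop two_pos)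
  have := (tendsto_erfc_atTop.comp (h1.atTop_add h2)).const_mul (exp (x * w))
  rw [mul_zero] at this
  exact this

lemma tendsto_gaussPrim_zero_pos (x : ℝ) {w : ℝ} (hw : 0 < w) :
    Tendsto (gaussPrim x w) (𝓝[>] 0) (𝓝 0) := by
  have h2 : Tendsto (fun t => w / (2 * √t)) (𝓝[>] 0) atTop := by
    have := tendsto_inv_sqrt_nhdsGT.const_mul_atTop (show 0 < w / 2 by positivity)
    refine this.congr fun t => ?_
    ring
  have h1 : Tendsto (fun t => x * √t) (𝓝[>] 0) (𝓝 0) := by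
    simpa using tendsto_sqrt_nhdsGT.const_mul x
  have := (tendsto_erfc_atTop.comp (h1.add_atTop h2)).const_mul (exp (x * w))
  rw [mul_zero] at this
  exact this

lemma tendsto_gaussPrim_zero_neg (x : ℝ) {w : ℝ} (hw : 0 < w) :
    Tendsto (gaussPrim x (-w)) (𝓝[>] 0) (𝓝 (2 * exp (-(x * w)))) := by
  have h2 : Tendsto (fun t => (-w) / (2 * √t)) (𝓝[>] 0) atBot := by
    have := tendsto_inv_sqrt_nhdsGT.const_mul_atTop_of_neg (show -w / 2 < 0 by linarith)
    refine this.congr fun t => ?_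
    ring
  have h1 : Tendsto (fun t => x * √t) (𝓝[>] 0) (𝓝 0) := by
    simpa using tendsto_sqrt_nhdsGT.const_mul x
  have := (tendsto_erfc_atBot.comp (h1.add_atBot h2)).const_mul (exp (x * -w))
  rw [mul_neg, mul_comm (exp _)] at this
  refine this.congr fun t => ?_
  rw [gaussPrim, mul_neg]
  rfl

section GaussLaplace

variable {x w : ℝ}

/-- The Gaussian-exponential weight `e^{-x²t} e^{-w²/(4t)}`. -/
noncomputable def gaussExp (x w t : ℝ) : ℝ := exp (-x ^ 2 * t) * exp (-(w ^ 2 / (4 * t)))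

lemma integral_gaussExp_div_sqrt (hx : 0 < x) (hw : 0 < w) :
    IntegrableOn (fun t => gaussExp x w t / √t) (Ioi 0) ∧
      ∫ t in Ioi (0 : ℝ), gaussExp x w t / √t = √π / x * exp (-(x * w)) := by
  have hpi : √π ≠ 0 := (sqrt_pos.2 pi_pos).ne'
  have hd : ∀ t > 0, HasDerivAt (fun t => -(√π / (2 * x)) * (gaussPrim x w t + gaussPrim x (-w) t))
      (gaussExp x w t / √t) t := by
    intro t ht
    have hs : 0 < √t := sqrt_pos.2 ht
    convert! ((hasDerivAt_gaussPrim x w ht).add (hasDerivAt_gaussPrim x (-w) ht)).const_mul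
      (-(√π / (2 * x))) using 1
    rw [gaussExp, neg_sq]
    field_simp
    ring
  have h0 : Tendsto (fun t => -(√π / (2 * x)) * (gaussPrim x w t + gaussPrim x (-w) t)) (𝓝[>] 0)
      (𝓝 (-(√π / (2 * x)) * (0 + 2 * exp (-(x * w))))) :=
    ((tendsto_gaussPrim_zero_pos x hw).add (tendsto_gaussPrim_zero_neg x hw)).const_mul _
  have hi : Tendsto (fun t => -(√π / (2 * x)) * (gaussPrim x w t + gaussPrim x (-w) t)) atTop
      (𝓝 (-(√π / (2 * x)) * (0 + 0))) :=
    ((tendsto_gaussPrim_atTop hx w).add (tendsto_gaussPrim_atTop hx (-w))).const_mul _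
  have hint := integrableOn_Ioi_zero_of_tendsto hd
    (fun t _ => by rw [gaussExp]; positivity) h0 hi
  refine ⟨hint, ?_⟩
  rw [integral_Ioi_zero_of_tendsto hd hint h0 hi]
  field_simp
  ring

lemma integral_gaussExp_div_mul_sqrt (hx : 0 < x) (hw : 0 < w) :
    ∫ t in Ioi (0 : ℝ), gaussExp x w t / (t * √t) = 2 * √π / w * exp (-(x * w)) := by
  have hpi : √π ≠ 0 := (sqrt_pos.2 pi_pos).ne'
  have hd : ∀ t > 0, HasDerivAt (fun t => √π / w * (gaussPrim x w t - gaussPrim x (-w) t))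
      (gaussExp x w t / (t * √t)) t := by
    intro t ht
    have hs : 0 < √t := sqrt_pos.2 ht
    convert! ((hasDerivAt_gaussPrim x w ht).sub (hasDerivAt_gaussPrim x (-w) ht)).const_mul
      (√π / w) using 1
    rw [gaussExp, neg_sq]
    field_simp
    ring
  have h0 : Tendsto (fun t => √π / w * (gaussPrim x w t - gaussPrim x (-w) t)) (𝓝[>] 0)
      (𝓝 (√π / w * (0 - 2 * exp (-(x * w))))) :=
    ((tendsto_gaussPrim_zero_pos x hw).sub (tendsto_gaussPrim_zero_neg x hw)).const_mul _
  have hi : Tendsto (fun t => √π / w * (gaussPrim x w t - gaussPrim x (-w) t)) atTop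
      (𝓝 (√π / w * (0 - 0))) :=
    ((tendsto_gaussPrim_atTop hx w).sub (tendsto_gaussPrim_atTop hx (-w))).const_mul _
  have hint := integrableOn_Ioi_zero_of_tendsto hd
    (fun t ht => by
      have : 0 < t := ht
      rw [gaussExp]; positivity) h0 hi
  rw [integral_Ioi_zero_of_tendsto hd hint h0 hi]
  field_simp
  ring

/-- The derivative of e^{-x²t - w²/(4t)}/√t has integral zero, both end values being 0, so the
integral sought is x² times the one in `integral_gaussExp_div_sqrt`. -/
lemma integral_gaussExp_heat (hx : 0 < x) (hw : 0 < w)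
    (hint : IntegrableOn (fun t => gaussExp x w t * (w ^ 2 / (4 * t) - 1 / 2) / (t * √t))
      (Ioi 0)) :
    ∫ t in Ioi (0 : ℝ), gaussExp x w t * (w ^ 2 / (4 * t) - 1 / 2) / (t * √t)
      = √π * x * exp (-(x * w)) := by
  obtain ⟨hi1, hv1⟩ := integral_gaussExp_div_sqrt hx hw
  have hd : ∀ t > 0, HasDerivAt (fun t => gaussExp x w t / √t)
      (gaussExp x w t * (w ^ 2 / (4 * t) - 1 / 2) / (t * √t) - x ^ 2 * (gaussExp x w t / √t)) t := by
    intro t ht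
    have hs : 0 < √t := sqrt_pos.2 ht
    have hss : √t ^ 2 = t := sq_sqrt ht.le
    have h1 : HasDerivAt (fun t => exp (-x ^ 2 * t)) (exp (-x ^ 2 * t) * (-x ^ 2 * 1)) t :=
      ((hasDerivAt_id t).const_mul (-x ^ 2)).exp
    have h2 : HasDerivAt (fun t => exp (-(w ^ 2 / (4 * t))))
        (exp (-(w ^ 2 / (4 * t))) * (-((0 * (4 * t) - w ^ 2 * (4 * 1)) / (4 * t) ^ 2))) t :=
      (((hasDerivAt_const t (w ^ 2)).div ((hasDerivAt_id t).const_mul 4)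
        (by positivity)).neg).exp
    have h3 := (h1.mul h2).div (hasDerivAt_sqrt ht.ne') hs.ne'
    convert! h3 using 1
    rw [hss, gaussExp]
    simp only [Pi.mul_apply]
    field_simp
    rw [hss]
    ring
  have hg : ∀ t > 0, gaussExp x w t / √t ≤ 4 / w ^ 2 * √t := by
    intro t ht
    have hs : 0 < √t := sqrt_pos.2 ht
    have hss : √t ^ 2 = t := sq_sqrt (le_of_lt ht)
    have h1 : exp (-x ^ 2 * t) ≤ 1 := exp_le_one_iff.2 (by have := sq_nonneg x; nlinarith)
    have h2 : exp (-(w ^ 2 / (4 * t))) ≤ 4 * t / w ^ 2 := by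
      rw [exp_neg, inv_le_comm₀ (exp_pos _) (by positivity), inv_div]
      linarith [add_one_le_exp (w ^ 2 / (4 * t))]
    rw [div_le_iff₀ hs, gaussExp]
    calc exp (-x ^ 2 * t) * exp (-(w ^ 2 / (4 * t))) ≤ 1 * (4 * t / w ^ 2) := by gcongr
      _ = _ := by rw [mul_assoc, ← sq, hss]; ring
  have hg2 : ∀ t > 0, gaussExp x w t / √t ≤ 1 / √t := by
    intro t ht
    have h1 : exp (-x ^ 2 * t) ≤ 1 := exp_le_one_iff.2 (by have := sq_nonneg x; nlinarith)
    have h2 : exp (-(w ^ 2 / (4 * t))) ≤ 1 := exp_le_one_iff.2 (by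
      have : 0 ≤ w ^ 2 / (4 * t) := by have : 0 < t := ht; positivity
      linarith)
    rw [gaussExp]
    gcongr
    exact mul_le_one₀ h1 (exp_pos _).le h2
  have h0 : Tendsto (fun t => gaussExp x w t / √t) (𝓝[>] 0) (𝓝 0) := by
    have hl := tendsto_sqrt_nhdsGT.const_mul (4 / w ^ 2)
    rw [mul_zero] at hl
    refine squeeze_zero' (Eventually.of_forall fun t => ?_) ?_ hl
    · rw [gaussExp]; positivity
    · filter_upwards [self_mem_nhdsWithin] with t ht using hg t ht
  have hi : Tendsto (fun t => gaussExp x w t / √t) atTop (𝓝 0) := by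
    refine squeeze_zero' (Eventually.of_forall fun t => ?_) ?_
      (tendsto_const_nhds.div_atTop tendsto_sqrt_atTop (a := 1))
    · rw [gaussExp]; positivity
    · filter_upwards [eventually_gt_atTop 0] with t ht using hg2 t ht
  have := integral_Ioi_zero_of_tendsto hd (hint.sub (hi1.const_mul _)) h0 hi
  rw [integral_sub hint (hi1.const_mul _), integral_const_mul, hv1, sub_zero] at this
  rw [sub_eq_zero.1 this]
  field_simp

end GaussLaplace

/-! ### Self-similar averages -/

/-- The self-similar average `∫ t⁻¹ χ(z/√t) w(z) dz`. -/
noncomputable def profileAvg (χ w : ℝ → ℝ) (t : ℝ) : ℝ := ∫ z, t⁻¹ * χ (z / √t) * w z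

section ProfileAvg

variable {χ w : ℝ → ℝ} {C : ℝ}

/-- After z = √t y only a prefactor t^{-1/2} and the dilated datum depend on t; the bound and the
continuity in t are read off from this form. -/
lemma profileAvg_eq {t : ℝ} (ht : 0 < t) (χ w : ℝ → ℝ) :
    profileAvg χ w t = (√t)⁻¹ * ∫ y, χ y * w (√t * y) := by
  have hs : 0 < √t := sqrt_pos.2 ht
  have h := Measure.integral_comp_div (fun y => χ y * w (√t * y)) √t
  simp only [mul_div_cancel₀ _ hs.ne', smul_eq_mul, abs_of_pos hs] at h
  rw [profileAvg]
  simp only [mul_assoc]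
  rw [integral_const_mul, h, ← mul_assoc]
  congr 1
  have := mul_self_sqrt ht.le
  field_simp
  rw [sq, this]

lemma integral_profile {t : ℝ} (ht : 0 < t) (χ : ℝ → ℝ) :
    ∫ z, t⁻¹ * χ (z / √t) = (√t)⁻¹ * ∫ y, χ y := by
  simpa [profileAvg] using profileAvg_eq ht χ fun _ => 1

lemma abs_profileAvg_le (hχ : Integrable χ) (hw : ∀ z, |w z| ≤ C) {t : ℝ} (ht : 0 < t) :
    |profileAvg χ w t| ≤ (C * ∫ y, |χ y|) / √t := by
  rw [profileAvg_eq ht, abs_mul, abs_of_pos (inv_pos.2 (sqrt_pos.2 ht)), inv_mul_eq_div]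
  gcongr
  rw [← integral_const_mul]
  rw [← norm_eq_abs]
  refine norm_integral_le_of_norm_le (hχ.abs.const_mul C) (Eventually.of_forall fun y => ?_)
  rw [norm_mul, mul_comm, norm_eq_abs, norm_eq_abs]
  exact mul_le_mul_of_nonneg_right (hw _) (abs_nonneg _)

/-- Continuity of w is not required at 0, because w will also be a difference quotient at 0. -/
lemma continuousOn_profileAvg (hχ : Integrable χ) (hw : ∀ z, |w z| ≤ C) (hwm : Measurable w)
    (hwc : ∀ z ≠ 0, ContinuousAt w z) : ContinuousOn (profileAvg χ w) (Ioi 0) := by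
  have h : ContinuousOn (fun t => (√t)⁻¹ * ∫ y, χ y * w (√t * y)) (Ioi 0) := by
    refine ContinuousOn.mul ?_ fun t ht => ContinuousAt.continuousWithinAt ?_
    · exact ContinuousOn.inv₀ (by fun_prop) fun t ht => (sqrt_pos.2 ht).ne'
    · refine continuousAt_of_dominated (bound := fun y => |χ y| * C) ?_ ?_ (hχ.abs.mul_const C) ?_
      · refine Eventually.of_forall fun s => ?_
        exact hχ.aestronglyMeasurable.mul (hwm.comp (by fun_prop)).aestronglyMeasurable
      · refine Eventually.of_forall fun s => Eventually.of_forall fun y => ?_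
        rw [norm_mul, norm_eq_abs, norm_eq_abs]
        exact mul_le_mul_of_nonneg_left (hw _) (abs_nonneg _)
      · have : ∀ᵐ y : ℝ, y ≠ 0 := by simp [ae_iff]
        filter_upwards [this] with y hy
        refine continuousAt_const.mul ?_
        refine ContinuousAt.comp (f := fun s => √s * y) (g := w)
          (hwc _ (mul_ne_zero (sqrt_pos.2 ht).ne' hy)) (by fun_prop)
  exact h.congr fun t ht => profileAvg_eq ht χ w

lemma lapIntegrable_profileAvg (hχ : Integrable χ) (hw : ∀ z, |w z| ≤ C) (hwm : Measurable w)
    (hwc : ∀ z ≠ 0, ContinuousAt w z) {p : ℝ} (hp : 0 < p) : LapIntegrable (profileAvg χ w) p := by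
  refine Integrable.mono' ((integrableOn_exp_div_sqrt hp).const_mul (C * ∫ y, |χ y|)) ?_ ?_
  · exact ((Continuous.continuousOn (by fun_prop)).mul
      (continuousOn_profileAvg hχ hw hwm hwc)).aestronglyMeasurable measurableSet_Ioi
  · filter_upwards [ae_restrict_mem measurableSet_Ioi] with t ht
    rw [norm_mul, norm_of_nonneg (exp_pos _).le]
    calc exp (-p * t) * ‖profileAvg χ w t‖ ≤ exp (-p * t) * ((C * ∫ y, |χ y|) / √t) := by
          gcongr; exact abs_profileAvg_le hχ hw ht
      _ = _ := by ring

lemma weaklySingular_profileAvg (hχ : Integrable χ) (hw : ∀ z, |w z| ≤ C) (hwm : Measurable w)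
    (hwc : ∀ z ≠ 0, ContinuousAt w z) : WeaklySingular (profileAvg χ w) := by
  have hC : 0 ≤ C := (abs_nonneg _).trans (hw 0)
  refine ⟨continuousOn_profileAvg hχ hw hwm hwc, C * ∫ y, |χ y|, 0, ?_, le_rfl, fun t ht => ?_⟩
  · exact mul_nonneg hC (integral_nonneg fun _ => abs_nonneg _)
  · simpa [div_eq_mul_inv] using abs_profileAvg_le hχ hw ht

lemma integrable_prod_profile (hχ : Integrable χ) (hχm : Measurable χ) {p : ℝ} (hp : 0 < p) :
    Integrable (fun q : ℝ × ℝ => exp (-p * q.1) * (q.1⁻¹ * χ (q.2 / √q.1)))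
      ((volume.restrict (Ioi 0)).prod volume) := by
  rw [integrable_prod_iff (Measurable.aestronglyMeasurable (by fun_prop))]
  refine ⟨?_, ?_⟩
  · filter_upwards [ae_restrict_mem measurableSet_Ioi] with t ht
    exact ((hχ.comp_div (sqrt_pos.2 ht).ne').const_mul _).const_mul _
  · refine IntegrableOn.congr_fun ((integrableOn_exp_div_sqrt hp).mul_const (∫ y, |χ y|))
      (fun t ht => ?_) measurableSet_Ioi
    have ht' : (0 : ℝ) < t := ht
    have h := integral_profile ht' fun y => |χ y|
    simp only [norm_mul, norm_eq_abs, abs_exp, abs_inv, abs_of_pos ht']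
    rw [integral_const_mul, h]
    ring

/-- Fubini reduces the transform to that of the kernel at fixed z. It also supplies integrability in
t for almost every z, which is why Θ may be computed under that assumption. -/
lemma laplace_profileAvg (hχ : Integrable χ) (hχm : Measurable χ) (hw : ∀ z, |w z| ≤ C)
    (hwm : Measurable w) {p : ℝ} (hp : 0 < p) {Θ : ℝ → ℝ}
    (hΘ : ∀ z ≠ 0, LapIntegrable (fun t => t⁻¹ * χ (z / √t)) p →
      laplace (fun t => t⁻¹ * χ (z / √t)) p = Θ z) :
    laplace (profileAvg χ w) p = ∫ z, Θ z * w z := by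
  have hprod := integrable_prod_profile hχ hχm hp
  have hprod' : Integrable (fun q : ℝ × ℝ => exp (-p * q.1) * (q.1⁻¹ * χ (q.2 / √q.1)) * w q.2)
      ((volume.restrict (Ioi 0)).prod volume) :=
    hprod.mul_bdd (c := C) (hwm.comp measurable_snd).aestronglyMeasurable
      (Eventually.of_forall fun q => hw _)
  have hswap := integral_integral_swap
    (f := fun t z => exp (-p * t) * (t⁻¹ * χ (z / √t)) * w z) hprod'
  have hl : laplace (profileAvg χ w) p = ∫ t in Ioi (0 : ℝ), ∫ z,
      exp (-p * t) * (t⁻¹ * χ (z / √t)) * w z := by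
    rw [laplace]
    refine integral_congr_ae (Eventually.of_forall fun t => ?_)
    simp only
    rw [profileAvg, ← integral_const_mul]
    simp only [mul_assoc]
  rw [hl, hswap]
  refine integral_congr_ae ?_
  have hne : ∀ᵐ z : ℝ, z ≠ 0 := by simp [ae_iff]
  filter_upwards [hne, hprod.prod_left_ae] with z hz hint
  rw [integral_mul_const, ← hΘ z hz hint, laplace]

end ProfileAvg

/-! ### The free heat flow at the origin -/

lemma integrable_exp_neg_mul_abs {x : ℝ} (hx : 0 < x) : Integrable fun z : ℝ => exp (-x * |z|) := by
  rw [← integrableOn_univ, ← Iic_union_Ioi (a := (0 : ℝ)), integrableOn_union]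
  constructor
  · refine (integrableOn_exp_mul_Iic hx 0).congr_fun (fun z hz => ?_) measurableSet_Iic
    simp only [abs_of_nonpos (mem_Iic.1 hz), neg_mul_neg]
  · refine (exp_neg_integrableOn_Ioi 0 hx).congr_fun (fun z hz => ?_) measurableSet_Ioi
    simp only [abs_of_pos (mem_Ioi.1 hz)]

lemma integral_exp_neg_mul_abs {x : ℝ} (hx : 0 < x) : ∫ z : ℝ, exp (-x * |z|) = 2 / x := by
  rw [integral_comp_abs (f := fun z => exp (-x * z)), integral_exp_mul_Ioi (by linarith) 0]
  simp [div_eq_mul_inv]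

/-- The resolvent of the free Laplacian at spectral parameter `p`, evaluated at the origin. -/
noncomputable def freeResolvent (w : ℝ → ℝ) (p : ℝ) : ℝ :=
  (∫ z, exp (-√p * |z|) * w z) / (2 * √p)

lemma gVal_eq (a lam : ℝ) (w : ℝ → ℝ) : gVal a lam w = freeResolvent w (lam + a ^ 2) := by
  rw [gVal, greenConv, freeResolvent, ← integral_div]
  congr 1
  ext z
  rw [green, zero_sub, abs_neg]
  ring

lemma two_mul_sqrt_mul_gVal {a lam : ℝ} (h : 0 < lam + a ^ 2) (w : ℝ → ℝ) :
    2 * √(lam + a ^ 2) * gVal a lam w = ∫ z, exp (-√(lam + a ^ 2) * |z|) * w z := by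
  have := sqrt_pos.2 h
  rw [gVal_eq, freeResolvent]
  field_simp

/-- The profile of the kernel with Laplace transform `e^{-√p|z|}`. -/
noncomputable def fluxProfile (y : ℝ) : ℝ := |y| * exp (-(1 / 4) * y ^ 2) / (2 * √π)

/-- The profile of `z ∂ₜK_t(z)`, where `K_t` is the heat kernel. -/
noncomputable def heatProfile (y : ℝ) : ℝ :=
  y * (y ^ 2 / 4 - 1 / 2) * exp (-(1 / 4) * y ^ 2) / (2 * √π)

lemma integrable_fluxProfile : Integrable fluxProfile := by
  have h := (integrable_mul_exp_neg_mul_sq (b := 1 / 4) (by norm_num)).abs.div_const (2 * √π)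
  refine h.congr (Eventually.of_forall fun y => ?_)
  simp only [abs_mul, abs_exp, fluxProfile]

lemma integrable_heatProfile : Integrable heatProfile := by
  have h1 := integrable_mul_exp_neg_mul_sq (b := 1 / 4) (by norm_num)
  have h3 := integrable_rpow_mul_exp_neg_mul_sq (b := 1 / 4) (by norm_num) (s := 3) (by norm_num)
  refine (((h3.const_mul (1 / 4)).sub (h1.const_mul (1 / 2))).div_const (2 * √π)).congr
    (Eventually.of_forall fun y => ?_)
  simp only [heatProfile, Pi.sub_apply]
  rw [show y ^ (3 : ℝ) = y ^ 3 by norm_cast]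
  ring

lemma measurable_fluxProfile : Measurable fluxProfile := by
  unfold fluxProfile
  fun_prop

lemma measurable_heatProfile : Measurable heatProfile := by
  unfold heatProfile
  fun_prop

lemma exp_mul_scaled_gauss {p : ℝ} (hp : 0 < p) (z : ℝ) {t : ℝ} (ht : 0 < t) :
    exp (-p * t) * exp (-(1 / 4) * (z / √t) ^ 2) = gaussExp √p |z| t := by
  rw [gaussExp, sq_sqrt hp.le, sq_abs, div_pow, sq_sqrt ht.le]
  congr 2
  field_simp

lemma laplace_fluxProfile {p : ℝ} (hp : 0 < p) {z : ℝ} (hz : z ≠ 0) :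
    laplace (fun t => t⁻¹ * fluxProfile (z / √t)) p = exp (-√p * |z|) := by
  have hw : 0 < |z| := abs_pos.2 hz
  have hpi : √π ≠ 0 := (sqrt_pos.2 pi_pos).ne'
  have h := integral_gaussExp_div_mul_sqrt (sqrt_pos.2 hp) hw
  have h2 : laplace (fun t => t⁻¹ * fluxProfile (z / √t)) p =
      ∫ t in Ioi (0 : ℝ), |z| / (2 * √π) * (gaussExp √p |z| t / (t * √t)) := by
    refine setIntegral_congr_fun measurableSet_Ioi fun t ht => ?_
    have ht' : (0 : ℝ) < t := ht
    have hs : 0 < √t := sqrt_pos.2 ht'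
    simp only
    rw [← exp_mul_scaled_gauss hp z ht', fluxProfile, abs_div, abs_of_pos hs]
    field_simp
  rw [h2, integral_const_mul, h, neg_mul]
  field_simp

lemma laplace_heatProfile {p : ℝ} (hp : 0 < p) {z : ℝ} (hz : z ≠ 0)
    (hint : LapIntegrable (fun t => t⁻¹ * heatProfile (z / √t)) p) :
    laplace (fun t => t⁻¹ * heatProfile (z / √t)) p = z * (√p / 2) * exp (-√p * |z|) := by
  have hw : 0 < |z| := abs_pos.2 hz
  have hpi : √π ≠ 0 := (sqrt_pos.2 pi_pos).ne'
  have hpt : ∀ t ∈ Ioi (0 : ℝ), exp (-p * t) * (t⁻¹ * heatProfile (z / √t)) =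
      z / (2 * √π) * (gaussExp √p |z| t * (|z| ^ 2 / (4 * t) - 1 / 2) / (t * √t)) := by
    intro t ht
    have ht' : (0 : ℝ) < t := ht
    have hs : 0 < √t := sqrt_pos.2 ht'
    rw [← exp_mul_scaled_gauss hp z ht', heatProfile, sq_abs]
    have : (z / √t) ^ 2 / 4 = z ^ 2 / (4 * t) := by
      rw [div_pow, sq_sqrt ht'.le]; field_simp
    rw [this]
    field_simp
  have hint' : IntegrableOn (fun t => gaussExp √p |z| t * (|z| ^ 2 / (4 * t) - 1 / 2) / (t * √t))
      (Ioi 0) := by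
    have h1 := IntegrableOn.congr_fun hint hpt measurableSet_Ioi
    refine (h1.const_mul (2 * √π / z)).congr (Eventually.of_forall fun t => ?_)
    simp only
    rw [← mul_assoc, div_mul_div_cancel₀ hz, div_self (by positivity), one_mul]
  have h := integral_gaussExp_heat (sqrt_pos.2 hp) hw hint'
  rw [laplace, setIntegral_congr_fun measurableSet_Ioi hpt, integral_const_mul, h, neg_mul]
  field_simp

section InitialData

variable {w : ℝ → ℝ} {C : ℝ}

lemma laplace_flux (hwc : Continuous w) (hw : ∀ z, |w z| ≤ C) {p : ℝ} (hp : 0 < p) :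
    laplace (profileAvg fluxProfile w) p = ∫ z, exp (-√p * |z|) * w z :=
  laplace_profileAvg integrable_fluxProfile measurable_fluxProfile hw hwc.measurable hp
    fun _ hz _ => laplace_fluxProfile hp hz

lemma laplace_exp_mul (c : ℝ) (f : ℝ → ℝ) (lam : ℝ) :
    laplace (fun t => exp (-c * t) * f t) lam = laplace f (lam + c) := by
  rw [laplace, laplace]
  congr 1
  ext s
  rw [← mul_assoc, ← exp_add]
  ring_nf

/-- 2κ G^a_λ(z) = e^{-κ|z|} is the transform of e^{-a²t}|z| e^{-z²/(4t)}/(2√π t^{3/2}), so the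
inverse transform is an average of w against this kernel. -/
lemma exists_inverse_laplace (a : ℝ) (hwc : Continuous w) (hw : ∀ z, |w z| ≤ C) :
    ∃ H, WeaklySingular H ∧ IsInverseLaplace (fun lam => 2 * √(lam + a ^ 2) * gVal a lam w) H := by
  have hS := weaklySingular_profileAvg integrable_fluxProfile hw hwc.measurable
    fun z _ => hwc.continuousAt
  refine ⟨fun t => exp (-a ^ 2 * t) * profileAvg fluxProfile w t, hS.exp_mul _,
    (hS.exp_mul _).continuousOn, fun lam hlam => ?_, fun lam hlam => ?_⟩
  · have hp : 0 < lam + a ^ 2 := by have : 0 < lam := hlam; positivity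
    refine IntegrableOn.congr_fun (lapIntegrable_profileAvg integrable_fluxProfile hw
      hwc.measurable (fun z _ => hwc.continuousAt) hp) (fun t _ => ?_) measurableSet_Ioi
    rw [← mul_assoc, ← exp_add]
    ring_nf
  · have hp : 0 < lam + a ^ 2 := by have : 0 < lam := hlam; positivity
    rw [laplace_exp_mul, laplace_flux hwc hw hp, two_mul_sqrt_mul_gVal hp]

/-- Heat kernels K_t have constant mass, so formally ∂ₜ∫K_t w = ∫ z ∂ₜK_t(z) · (w(z) - w(0))/z dz.
The Lipschitz bound controls the quotient and leaves an O(t^{-1/2}) function. -/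
lemma exists_hasLaplace_heat {K : NNReal} (hK : LipschitzWith K w) (hw : ∀ z, |w z| ≤ C) :
    ∃ U, HasLaplace U fun p => p * freeResolvent w p - w 0 := by
  have hwc := hK.continuous
  set q : ℝ → ℝ := fun z => (w z - w 0) / z with hq
  have hqb : ∀ z, |q z| ≤ K := by
    intro z
    have h := hK.dist_le_mul z 0
    rw [dist_eq, dist_eq, sub_zero] at h
    rw [hq, abs_div]
    exact div_le_of_le_mul₀ (abs_nonneg _) K.2 h
  have hqm : Measurable q := (hwc.measurable.sub_const _).div measurable_id
  have hqc : ∀ z ≠ 0, ContinuousAt q z := fun z hz =>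
    (hwc.continuousAt.sub continuousAt_const).div continuousAt_id hz
  refine ⟨profileAvg heatProfile q,
    weaklySingular_profileAvg integrable_heatProfile hqb hqm hqc, ?_⟩
  filter_upwards [eventually_gt_atTop 0] with p hp
  have hx : 0 < √p := sqrt_pos.2 hp
  rw [laplace_profileAvg integrable_heatProfile measurable_heatProfile hqb hqm hp
    fun z hz h => laplace_heatProfile hp hz h]
  have hi := integrable_exp_neg_mul_abs hx
  have hiw : Integrable fun z => exp (-√p * |z|) * w z :=
    hi.mul_bdd (c := C) hwc.aestronglyMeasurable (Eventually.of_forall hw)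
  have h1 : ∫ z, z * (√p / 2) * exp (-√p * |z|) * q z =
      ∫ z, √p / 2 * (exp (-√p * |z|) * w z - exp (-√p * |z|) * w 0) := by
    have hne : ∀ᵐ z : ℝ, z ≠ 0 := by simp [ae_iff]
    refine integral_congr_ae ?_
    filter_upwards [hne] with z hz
    rw [hq]
    field_simp
  rw [h1, integral_const_mul, integral_sub hiw (hi.mul_const _), integral_mul_const,
    integral_exp_neg_mul_abs hx, freeResolvent]
  have h2 := sq_sqrt hp.le
  set I := ∫ z, exp (-√p * |z|) * w z
  field_simp
  linear_combination I * h2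

/-- The trace at the origin of the solution with initial perturbation `w`, as the primitive of a
weakly singular function with explicit Laplace transform. -/
theorem exists_trace {a b : ℝ} (hb : 0 < b) {K : NNReal} (hK : LipschitzWith K w)
    (hw : ∀ z, |w z| ≤ C) : ∃ ξ : ℝ → ℝ, ξ 0 = 1 + w 0 ∧
      HasLaplace ξ (fun lam => √(lam + a ^ 2) * (1 / lam + gVal a lam w) / (√(lam + a ^ 2) + b)) ∧
      ∀ H, IsInverseLaplace (fun lam => 2 * √(lam + a ^ 2) * gVal a lam w) H →
        SolvesMemoryEq a b (fun t => mKer a t * w 0 - H t) ξ := by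
  obtain ⟨U, hU⟩ := exists_hasLaplace_heat hK hw
  obtain ⟨D, hD⟩ := exists_solution_derivative (a := a) hb hU
  refine ⟨fun t => 1 + w 0 + ∫ s in (0 : ℝ)..t, D s, by simp, ?_, fun H hH => ?_⟩
  · refine ((HasLaplace.const (1 + w 0)).add hD.primitive).congr (fun t _ => rfl) ?_
    filter_upwards [eventually_gt_atTop 0] with lam hlam
    have hx : 0 < √(lam + a ^ 2) := sqrt_pos.2 (by positivity)
    rw [gVal_eq]
    field_simp
    ring
  · obtain ⟨H₀, hH₀, hH₀'⟩ := exists_inverse_laplace a hK.continuous hw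
    have hl : HasLaplace H₀ fun lam => 2 * √(lam + a ^ 2) * gVal a lam w := ⟨hH₀, by
      filter_upwards [eventually_gt_atTop 0] with lam hlam using hH₀'.laplace_eq lam hlam⟩
    have hR := ((hasLaplace_mKer a).const_mul (w 0)).sub hl
    refine (solvesMemoryEq_primitive (ξ₀ := 1 + w 0) hD hR ?_).congr (fun t ht => ?_)
      fun t _ => rfl
    · filter_upwards [eventually_gt_atTop 0] with lam hlam
      have hp : 0 < lam + a ^ 2 := by positivity
      have hx : 0 < √(lam + a ^ 2) := sqrt_pos.2 hp
      rw [gVal_eq]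
      field_simp
      ring
    · simp only
      rw [hl.eqOn_of_isInverseLaplace hH ht, mul_comm]

end InitialData

/-! ### Weak derivatives on intervals -/

/-- Smooth functions with compact support in `U`. -/
structure IsTest (U : Set ℝ) (τ : ℝ → ℝ) : Prop where
  smooth : ContDiff ℝ ∞ τ
  compact : HasCompactSupport τ
  tsupport_subset : tsupport τ ⊆ U

namespace IsTest

variable {U : Set ℝ} {τ σ : ℝ → ℝ}

lemma sub_const_mul (hτ : IsTest U τ) (c : ℝ) (hσ : IsTest U σ) :
    IsTest U fun x => τ x - c * σ x := by
  refine ⟨hτ.smooth.sub (contDiff_const.mul hσ.smooth), hτ.compact.sub hσ.compact.mul_left, ?_⟩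
  have h : tsupport (fun x => τ x - c * σ x) ⊆ tsupport τ ∪ tsupport σ := by
    refine closure_minimal (fun x hx => ?_) ((isClosed_tsupport _).union (isClosed_tsupport _))
    by_contra hcon
    rw [mem_union, not_or] at hcon
    exact hx (by simp [image_eq_zero_of_notMem_tsupport hcon.1,
      image_eq_zero_of_notMem_tsupport hcon.2])
  exact h.trans (union_subset hτ.tsupport_subset hσ.tsupport_subset)

lemma deriv (hτ : IsTest U τ) : IsTest U (deriv τ) :=
  ⟨(contDiff_infty_iff_deriv.1 hτ.smooth).2, hτ.compact.deriv,
    tsupport_deriv_subset.trans hτ.tsupport_subset⟩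

lemma hasDerivAt (hτ : IsTest U τ) (x : ℝ) : HasDerivAt τ (_root_.deriv τ x) x :=
  ((contDiff_infty_iff_deriv.1 hτ.smooth).1 x).hasDerivAt

lemma continuous (hτ : IsTest U τ) : Continuous τ := hτ.smooth.continuous

lemma integrable (hτ : IsTest U τ) : Integrable τ :=
  hτ.continuous.integrable_of_hasCompactSupport hτ.compact

lemma integrable_mul (hτ : IsTest U τ) {f : ℝ → ℝ} (hf : Continuous f) :
    Integrable fun x => τ x * f x :=
  (hτ.continuous.mul hf).integrable_of_hasCompactSupport hτ.compact.mul_right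

lemma integral_deriv_mul (hτ : IsTest U τ) {f f' : ℝ → ℝ} (hf : ∀ x, HasDerivAt f (f' x) x)
    (hf' : Continuous f') : ∫ x, _root_.deriv τ x * f x = -∫ x, τ x * f' x := by
  have hfc : Continuous f := continuous_iff_continuousAt.2 fun x => (hf x).continuousAt
  have := integral_mul_deriv_eq_deriv_mul_of_integrable (u := τ) (v := f) (u' := _root_.deriv τ)
    (v' := f') (fun x _ => hτ.hasDerivAt x) (fun x _ => hf x) (hτ.integrable_mul hf')
    (hτ.deriv.integrable_mul hfc) (hτ.integrable_mul hfc)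
  rw [this, neg_neg]

lemma exists_bump (hU : IsOpen U) {x : ℝ} (hx : x ∈ U) :
    ∃ τ, IsTest U τ ∧ ∫ y, τ y = 1 := by
  obtain ⟨r, hr, hrU⟩ := Metric.isOpen_iff.1 hU x hx
  let f : ContDiffBump x := ⟨r / 4, r / 2, by positivity, by linarith⟩
  have hts : tsupport (f.normed volume) = Metric.closedBall x (r / 2) := f.tsupport_normed_eq
  refine ⟨f.normed volume, ⟨f.contDiff_normed, f.hasCompactSupport_normed, ?_⟩,
    f.integral_normed⟩
  rw [hts]
  exact (Metric.closedBall_subset_ball (by linarith)).trans hrU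

/-- The mean-zero condition makes the primitive vanish to the right of the support;
order-connectedness keeps the convex hull of the support inside U. -/
lemma exists_primitive (hU : OrdConnected U) (hτ : IsTest U τ) (h0 : ∫ x, τ x = 0) :
    ∃ P, IsTest U P ∧ _root_.deriv P = τ := by
  rcases (tsupport τ).eq_empty_or_nonempty with he | hne
  · have : τ = 0 := tsupport_eq_empty_iff.1 he
    subst this
    exact ⟨0, hτ, by simp⟩
  have hK : IsCompact (tsupport τ) := hτ.compact
  set A := sInf (tsupport τ) with hA
  set B := sSup (tsupport τ) with hB
  have hsub : tsupport τ ⊆ Icc A B := fun x hx =>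
    ⟨csInf_le hK.bddBelow hx, le_csSup hK.bddAbove hx⟩
  have hIU : Icc A B ⊆ U :=
    hU.out (hτ.tsupport_subset (hK.sInf_mem hne)) (hτ.tsupport_subset (hK.sSup_mem hne))
  have hz : ∀ x ∉ Icc A B, τ x = 0 := fun x hx =>
    image_eq_zero_of_notMem_tsupport fun h => hx (hsub h)
  have hd : ∀ x, HasDerivAt (fun x => ∫ y in A..x, τ y) (τ x) x := fun x =>
    intervalIntegral.integral_hasDerivAt_right (hτ.continuous.intervalIntegrable _ _)
      (hτ.continuous.stronglyMeasurableAtFilter _ _) hτ.continuous.continuousAt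
  have hderiv : _root_.deriv (fun x => ∫ y in A..x, τ y) = τ := funext fun x => (hd x).deriv
  have hPz : ∀ x ∉ Icc A B, ∫ y in A..x, τ y = 0 := by
    intro x hx
    rcases lt_or_ge x A with hxA | hxA
    · rw [intervalIntegral.integral_symm, intervalIntegral.integral_of_le hxA.le,
        integral_Ioc_eq_integral_Ioo, setIntegral_eq_zero_of_forall_eq_zero, neg_zero]
      exact fun y hy => hz y fun h => absurd h.1 (not_le.2 hy.2)
    · have hxB : B < x := not_le.1 fun h => hx ⟨hxA, h⟩
      rw [intervalIntegral.integral_of_le hxA, ← integral_Icc_eq_integral_Ioc,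
        setIntegral_eq_integral_of_forall_compl_eq_zero, h0]
      exact fun y hy => hz y fun h => hy ⟨h.1, h.2.trans hxB.le⟩
  refine ⟨fun x => ∫ y in A..x, τ y, ⟨?_, HasCompactSupport.intro isCompact_Icc hPz, ?_⟩, hderiv⟩
  · rw [contDiff_infty_iff_deriv, hderiv]
    exact ⟨fun x => (hd x).differentiableAt, hτ.smooth⟩
  · refine subset_trans (closure_minimal (fun x hx => ?_) isClosed_Icc) hIU
    by_contra hcon
    exact hx (hPz x hcon)

end IsTest

/-- The lemma of du Bois-Reymond. -/
lemma eq_const_of_weak_deriv_eq_zero {U : Set ℝ} (hU : IsOpen U) (hc : OrdConnected U)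
    {f : ℝ → ℝ} (hf : Continuous f) (h : ∀ τ, IsTest U τ → ∫ x, deriv τ x * f x = 0) :
    ∃ c, ∀ x ∈ U, f x = c := by
  rcases U.eq_empty_or_nonempty with rfl | ⟨x₀, hx₀⟩
  · exact ⟨0, by simp⟩
  obtain ⟨ρ, hρ, hρ1⟩ := IsTest.exists_bump hU hx₀
  set c := ∫ x, ρ x * f x with hcdef
  refine ⟨c, ?_⟩
  have hae : ∀ᵐ x : ℝ, x ∈ U → f x - c = 0 := by
    refine hU.ae_eq_zero_of_integral_contDiff_smul_eq_zero
      ((hf.sub continuous_const).locallyIntegrable.locallyIntegrableOn _) fun g hg hg2 hg3 => ?_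
    have hgt : IsTest U g := ⟨hg, hg2, hg3⟩
    -- Subtracting (∫g)ρ from g gives mean zero, hence the derivative of an admissible test
    -- function.
    obtain ⟨P, hP, hPd⟩ := (hgt.sub_const_mul (∫ x, g x) hρ).exists_primitive hc (by
      rw [integral_sub hgt.integrable (hρ.integrable.const_mul _), integral_const_mul, hρ1]
      ring)
    have h1 := h P hP
    rw [hPd] at h1
    simp only [sub_mul, mul_assoc] at h1
    rw [integral_sub (hgt.integrable_mul hf) ((hρ.integrable_mul hf).const_mul _),
      integral_const_mul] at h1
    simp only [smul_eq_mul, mul_sub]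
    rw [integral_sub (hgt.integrable_mul hf) (hgt.integrable.mul_const _), integral_mul_const]
    exact h1
  have hae' : f =ᵐ[volume.restrict U] fun _ => c := by
    rw [EventuallyEq, ae_restrict_iff' hU.measurableSet]
    filter_upwards [hae] with x hx hxU using sub_eq_zero.1 (hx hxU)
  exact fun x hx => Measure.eqOn_open_of_ae_eq hae' hU hf.continuousOn continuousOn_const hx

lemma hasDerivAt_primitive_of_continuous {h : ℝ → ℝ} (hh : Continuous h) (x : ℝ) :
    HasDerivAt (fun x => ∫ y in (0 : ℝ)..x, h y) (h x) x :=
  intervalIntegral.integral_hasDerivAt_right (hh.intervalIntegrable _ _)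
    (hh.stronglyMeasurableAtFilter _ _) hh.continuousAt

lemma eq_primitive_of_weak_deriv {U : Set ℝ} (hU : IsOpen U) (hc : OrdConnected U)
    {v h : ℝ → ℝ} (hv : Continuous v) (hh : Continuous h)
    (hw : ∀ τ, IsTest U τ → ∫ x, (deriv τ x * v x + τ x * h x) = 0) :
    ∃ c, ∀ x ∈ U, v x = c + ∫ y in (0 : ℝ)..x, h y := by
  have hd := hasDerivAt_primitive_of_continuous hh
  have hHc : Continuous fun x => ∫ y in (0 : ℝ)..x, h y :=
    continuous_iff_continuousAt.2 fun x => (hd x).continuousAt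
  obtain ⟨c, hcU⟩ := eq_const_of_weak_deriv_eq_zero hU hc
    (f := fun x => v x - ∫ y in (0 : ℝ)..x, h y) (hv.sub hHc) fun τ hτ => by
    simp only [mul_sub]
    rw [integral_sub (hτ.deriv.integrable_mul hv) (hτ.deriv.integrable_mul hHc),
      hτ.integral_deriv_mul hd hh, sub_neg_eq_add,
      ← integral_add (hτ.deriv.integrable_mul hv) (hτ.integrable_mul hh)]
    exact hw τ hτ
  exact ⟨c, fun x hx => by linarith [hcU x hx]⟩

/-- The weak derivative of Z can only be R₁ - c, with R₁ a primitive of r; once c is known, the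
first order lemma makes Z differentiable. -/
lemma exists_deriv_of_weak_deriv_two {Z r : ℝ → ℝ} (hZ : Continuous Z) (hr : Continuous r)
    (hw : ∀ ψ, IsTest univ ψ → ∫ x, deriv (deriv ψ) x * Z x = ∫ x, ψ x * r x) :
    ∃ Z' : ℝ → ℝ, (∀ x, HasDerivAt Z (Z' x) x) ∧ ∀ x, HasDerivAt Z' (r x) x := by
  have hd1 := hasDerivAt_primitive_of_continuous hr
  set R₁ : ℝ → ℝ := fun x => ∫ y in (0 : ℝ)..x, r y with hR₁
  have hR₁c : Continuous R₁ := continuous_iff_continuousAt.2 fun x => (hd1 x).continuousAt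
  obtain ⟨ρ, hρ, hρ1⟩ := IsTest.exists_bump isOpen_univ (mem_univ (0 : ℝ))
  -- The constant is forced by testing Z' = R₁ - c against ρ, which has integral 1.
  set c := ∫ x, (deriv ρ x * Z x + ρ x * R₁ x) with hc
  have key : ∀ τ, IsTest univ τ → ∫ x, (deriv τ x * Z x + τ x * (R₁ x - c)) = 0 := by
    intro τ hτ
    obtain ⟨P, hP, hPd⟩ := (hτ.sub_const_mul (∫ x, τ x) hρ).exists_primitive ordConnected_univ (by
      rw [integral_sub hτ.integrable (hρ.integrable.const_mul _), integral_const_mul, hρ1]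
      ring)
    have h1 := hw P hP
    have h2 := hP.integral_deriv_mul hd1 hr
    rw [hPd] at h1 h2
    have hdd : deriv (fun x => τ x - (∫ x, τ x) * ρ x) =
        fun x => deriv τ x - (∫ x, τ x) * deriv ρ x := by
      ext x
      exact ((hτ.hasDerivAt x).sub ((hρ.hasDerivAt x).const_mul _)).deriv
    rw [hdd] at h1
    simp only [sub_mul, mul_assoc] at h1 h2
    rw [integral_sub (hτ.deriv.integrable_mul hZ) ((hρ.deriv.integrable_mul hZ).const_mul _),
      integral_const_mul] at h1
    rw [integral_sub (hτ.integrable_mul hR₁c) ((hρ.integrable_mul hR₁c).const_mul _),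
      integral_const_mul] at h2
    rw [integral_add (hρ.deriv.integrable_mul hZ) (hρ.integrable_mul hR₁c)] at hc
    simp only [mul_sub]
    have h3 : Integrable fun x => τ x * R₁ x - τ x * c :=
      (hτ.integrable_mul hR₁c).sub (hτ.integrable.mul_const c)
    rw [integral_add (hτ.deriv.integrable_mul hZ) h3, integral_sub (hτ.integrable_mul hR₁c) (hτ.integrable.mul_const c), integral_mul_const]
    linear_combination h1 + h2 - (∫ x, τ x) * hc
  obtain ⟨c', hc'⟩ := eq_primitive_of_weak_deriv isOpen_univ ordConnected_univ hZ
    (hR₁c.sub continuous_const) key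
  refine ⟨fun x => R₁ x - c, fun x => ?_, fun x => (hd1 x).sub_const c⟩
  have := (hasDerivAt_primitive_of_continuous (hR₁c.sub (continuous_const (y := c))) x).const_add c'
  refine this.congr_of_eventuallyEq (Eventually.of_forall fun y => hc' y (mem_univ y))

/-! ### Second order equations on the half-line -/

/-- The expression -e^{-κy}(g' + κg) is an antiderivative of e^{-κy}F; boundedness of g removes the
growing mode e^{κy}. -/
lemma integral_exp_mul_of_ode {g g₁ F : ℝ → ℝ} {κ M N : ℝ} (hκ : 0 < κ)
    (hg : ∀ y, HasDerivAt g (g₁ y) y) (hg₁ : ∀ y ≥ 0, HasDerivAt g₁ (κ ^ 2 * g y - F y) y)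
    (hgb : ∀ y ≥ 0, |g y| ≤ M) (hFb : ∀ y, |F y| ≤ N) (hF : Continuous F) :
    ∫ y in Ioi (0 : ℝ), exp (-κ * y) * F y = g₁ 0 + κ * g 0 := by
  have hd : ∀ y ≥ 0, HasDerivAt (fun y => -(exp (-κ * y) * (g₁ y + κ * g y)))
      (exp (-κ * y) * F y) y := by
    intro y hy
    have h1 : HasDerivAt (fun y => exp (-κ * y)) (exp (-κ * y) * (-κ * 1)) y :=
      ((hasDerivAt_id y).const_mul (-κ)).exp
    convert! (h1.mul ((hg₁ y hy).add ((hg y).const_mul κ))).neg using 1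
    simp only [Pi.add_apply]
    ring
  have hint : IntegrableOn (fun y => exp (-κ * y) * F y) (Ioi 0) :=
    (exp_neg_integrableOn_Ioi 0 hκ).mul_bdd (c := N) hF.aestronglyMeasurable
      (Eventually.of_forall hFb)
  -- No bound on g' is assumed, but g'' is bounded by the equation, so g' grows at most linearly,
  -- which e^{-κy} absorbs.
  have hgrow : ∀ y ≥ 0, |g₁ y| ≤ |g₁ 0| + (κ ^ 2 * M + N) * y := by
    intro y hy
    have := (convex_Ici (0 : ℝ)).norm_image_sub_le_of_norm_hasDerivWithin_le (f := g₁)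
      (C := κ ^ 2 * M + N) (fun x hx => (hg₁ x hx).hasDerivWithinAt) (fun x hx => ?_)
      self_mem_Ici (mem_Ici.2 hy)
    · rw [sub_zero, norm_eq_abs, norm_eq_abs, abs_of_nonneg hy] at this
      linarith [abs_sub_abs_le_abs_sub (g₁ y) (g₁ 0)]
    · refine (norm_sub_le _ _).trans (add_le_add ?_ (hFb x))
      rw [norm_mul, norm_of_nonneg (sq_nonneg κ)]
      exact mul_le_mul_of_nonneg_left (hgb x hx) (sq_nonneg κ)
  have hlim : Tendsto (fun y => -(exp (-κ * y) * (g₁ y + κ * g y))) atTop (𝓝 0) := by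
    have hκt : Tendsto (fun y => κ * y) atTop atTop := tendsto_id.const_mul_atTop hκ
    have e1 : Tendsto (fun y => exp (-κ * y)) atTop (𝓝 0) := by
      refine (tendsto_exp_neg_atTop_nhds_zero.comp hκt).congr fun y => ?_
      rw [Function.comp_apply, neg_mul]
    have e2 : Tendsto (fun y => y * exp (-κ * y)) atTop (𝓝 0) := by
      have h := ((tendsto_pow_mul_exp_neg_atTop_nhds_zero 1).comp hκt).const_mul κ⁻¹
      rw [mul_zero] at h
      refine h.congr fun y => ?_
      simp only [Function.comp_apply, pow_one, neg_mul]
      rw [← mul_assoc, inv_mul_cancel_left₀ hκ.ne']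
    have e3 : Tendsto (fun y => (|g₁ 0| + κ * M) * exp (-κ * y)
        + (κ ^ 2 * M + N) * (y * exp (-κ * y))) atTop (𝓝 0) := by
      simpa using (e1.const_mul (|g₁ 0| + κ * M)).add (e2.const_mul (κ ^ 2 * M + N))
    refine squeeze_zero_norm' ?_ e3
    filter_upwards [eventually_ge_atTop 0] with y hy
    rw [norm_neg, norm_mul, norm_of_nonneg (exp_pos _).le]
    calc exp (-κ * y) * ‖g₁ y + κ * g y‖
        ≤ exp (-κ * y) * ((|g₁ 0| + (κ ^ 2 * M + N) * y) + κ * M) := by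
          gcongr
          refine (norm_add_le _ _).trans (add_le_add (hgrow y hy) ?_)
          rw [norm_mul, norm_of_nonneg hκ.le]
          exact mul_le_mul_of_nonneg_left (hgb y hy) hκ.le
      _ = _ := by ring
  have := integral_Ioi_of_hasDerivAt_of_tendsto' (a := 0) (fun y hy => hd y hy) hint hlim
  rw [this]
  simp

/-- The identity |x|'' = 2δ, used to absorb the point interaction. -/
lemma integral_abs_mul_deriv_two {ψ : ℝ → ℝ} (hψ : IsTest univ ψ) :
    ∫ x, deriv (deriv ψ) x * |x| = 2 * ψ 0 := by
  have hd : ∀ x, HasDerivAt (fun x => x * deriv ψ x - ψ x) (deriv (deriv ψ) x * x) x := by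
    intro x
    convert! ((hasDerivAt_id x).mul (hψ.deriv.hasDerivAt x)).sub (hψ.hasDerivAt x) using 1
    simp only [id]
    ring
  have hderiv : deriv (fun x => x * deriv ψ x - ψ x) = fun x => deriv (deriv ψ) x * x :=
    funext fun x => (hd x).deriv
  have hsm : ContDiff ℝ 1 fun x => x * deriv ψ x - ψ x :=
    ((contDiff_id.mul (hψ.deriv.smooth.of_le (by exact_mod_cast le_top))).sub
      (hψ.smooth.of_le (by exact_mod_cast le_top)))
  have hcs : HasCompactSupport fun x => x * deriv ψ x - ψ x :=
    (hψ.deriv.compact.mul_left).sub hψ.compact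
  have h1 := hcs.integral_Ioi_deriv_eq hsm 0
  have h2 := hcs.integral_Iic_deriv_eq hsm 0
  rw [hderiv] at h1 h2
  have hint := hψ.deriv.deriv.integrable_mul continuous_abs
  rw [← intervalIntegral.integral_Iic_add_Ioi (b := 0) hint.integrableOn hint.integrableOn]
  have e1 : ∫ x in Ioi (0 : ℝ), deriv (deriv ψ) x * |x| = ψ 0 := by
    rw [setIntegral_congr_fun (g := fun x => deriv (deriv ψ) x * x) measurableSet_Ioi
      fun x hx => by simp only [abs_of_pos (mem_Ioi.1 hx)], h1]
    simp
  have e2 : ∫ x in Iic (0 : ℝ), deriv (deriv ψ) x * |x| = ψ 0 := by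
    rw [setIntegral_congr_fun (g := fun x => -(deriv (deriv ψ) x * x)) measurableSet_Iic
      fun x hx => by simp only [abs_of_nonpos (mem_Iic.1 hx), mul_neg], integral_neg, h2]
    simp
  rw [e1, e2]
  ring

/-! ### Laplace transform in time of a bounded continuous function on the plane -/

lemma lapIntegrable_of_bounded {f : ℝ → ℝ} (hf : Continuous f) {C : ℝ} (hb : ∀ t, |f t| ≤ C)
    {lam : ℝ} (hlam : 0 < lam) : LapIntegrable f lam :=
  (exp_neg_integrableOn_Ioi 0 hlam).mul_bdd (c := C) hf.aestronglyMeasurable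
    (Eventually.of_forall hb)

section PlaneFunction

variable {W : ℝ → ℝ → ℝ} {C : ℝ}

lemma continuous_integral_mul (hW : Continuous fun p : ℝ × ℝ => W p.1 p.2)
    (hb : ∀ y t, |W y t| ≤ C) {θ : ℝ → ℝ} (hθ : Integrable θ) :
    Continuous fun t => ∫ y, θ y * W y t := by
  refine continuous_of_dominated (bound := fun y => |θ y| * C) (fun t => ?_) (fun t => ?_)
    (hθ.abs.mul_const C) (Eventually.of_forall fun y => ?_)
  · exact hθ.aestronglyMeasurable.mul
      (hW.comp (by fun_prop : Continuous fun y : ℝ => (y, t))).aestronglyMeasurable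
  · refine Eventually.of_forall fun y => ?_
    rw [norm_mul, norm_eq_abs, norm_eq_abs]
    exact mul_le_mul_of_nonneg_left (hb y t) (abs_nonneg _)
  · exact continuous_const.mul (hW.comp (by fun_prop : Continuous fun t : ℝ => (y, t)))

lemma abs_integral_mul_le (hb : ∀ y t, |W y t| ≤ C) {θ : ℝ → ℝ} (hθ : Integrable θ) (t : ℝ) :
    |∫ y, θ y * W y t| ≤ ∫ y, |θ y| * C := by
  rw [← norm_eq_abs]
  refine norm_integral_le_of_norm_le (hθ.abs.mul_const C) (Eventually.of_forall fun y => ?_)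
  rw [norm_mul, norm_eq_abs, norm_eq_abs]
  exact mul_le_mul_of_nonneg_left (hb y t) (abs_nonneg _)

lemma continuous_laplace_left (hW : Continuous fun p : ℝ × ℝ => W p.1 p.2)
    (hb : ∀ y t, |W y t| ≤ C) {lam : ℝ} (hlam : 0 < lam) :
    Continuous fun y => laplace (W y) lam := by
  refine continuous_of_dominated (bound := fun s => exp (-lam * s) * C) (fun y => ?_) (fun y => ?_)
    ((exp_neg_integrableOn_Ioi 0 hlam).mul_const C) (Eventually.of_forall fun s => ?_)
  · have : Continuous fun s : ℝ => W y s := hW.comp (by fun_prop : Continuous fun s : ℝ => (y, s))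
    exact (Continuous.mul (by fun_prop) this).aestronglyMeasurable
  · refine Eventually.of_forall fun s => ?_
    rw [norm_mul, norm_of_nonneg (exp_pos _).le]
    exact mul_le_mul_of_nonneg_left (hb y s) (exp_pos _).le
  · exact continuous_const.mul (hW.comp (by fun_prop : Continuous fun y : ℝ => (y, s)))

lemma abs_laplace_le (hb : ∀ y t, |W y t| ≤ C) {lam : ℝ} (hlam : 0 < lam) (y : ℝ) :
    |laplace (W y) lam| ≤ ∫ s in Ioi (0 : ℝ), exp (-lam * s) * C := by
  rw [← norm_eq_abs]
  refine norm_integral_le_of_norm_le ((exp_neg_integrableOn_Ioi 0 hlam).mul_const C)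
    (Eventually.of_forall fun s => ?_)
  rw [norm_mul, norm_of_nonneg (exp_pos _).le]
  exact mul_le_mul_of_nonneg_left (hb y s) (exp_pos _).le

lemma laplace_integral_mul (hW : Continuous fun p : ℝ × ℝ => W p.1 p.2)
    (hb : ∀ y t, |W y t| ≤ C) {θ : ℝ → ℝ} (hθ : Integrable θ) {lam : ℝ} (hlam : 0 < lam) :
    laplace (fun t => ∫ y, θ y * W y t) lam = ∫ y, θ y * laplace (W y) lam := by
  have hint : Integrable (fun q : ℝ × ℝ => exp (-lam * q.1) * θ q.2 * W q.2 q.1)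
      ((volume.restrict (Ioi 0)).prod volume) := by
    refine ((exp_neg_integrableOn_Ioi 0 hlam).mul_prod hθ).mul_bdd (c := C) ?_
      (Eventually.of_forall fun q => hb _ _)
    exact (hW.comp continuous_swap).aestronglyMeasurable
  have hswap := integral_integral_swap (f := fun t y => exp (-lam * t) * θ y * W y t) hint
  rw [laplace]
  simp only [← integral_const_mul, ← mul_assoc]
  rw [hswap]
  congr 1
  ext y
  rw [laplace, ← integral_const_mul]
  congr 1
  ext s
  ring

end PlaneFunction

/-! ### The Laplace transform of a bounded solution at the origin -/

section Solution

variable {a b : ℝ} {V₀ : ℝ → ℝ} {V : ℝ → ℝ → ℝ}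

namespace IsBoundedSolution

/-- Freezing V at its initial value for t < 0 gives a continuous bounded function on the whole
plane, so later integrals need no boundary care. -/
lemma continuous_extension (hV : IsBoundedSolution a b V₀ V) :
    Continuous fun p : ℝ × ℝ => V p.1 (max p.2 0) := by
  have := hV.continuousOn.comp_continuous (f := fun p : ℝ × ℝ => (p.1, max p.2 0)) (by fun_prop)
    fun p => show 0 ≤ max p.2 0 from le_max_right _ _
  exact this

lemma weak_equation (hV : IsBoundedSolution a b V₀ V) {ψ : ℝ → ℝ} (hψ : IsTest univ ψ) {τ : ℝ → ℝ}
    (hτ : IsTest (Ioi 0) τ) :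
    ∫ t, (deriv τ t * (∫ y, ψ y * V y (max t 0)) + τ t *
      ((∫ y, deriv (deriv ψ) y * V y (max t 0)) - a ^ 2 * (∫ y, ψ y * (V y (max t 0) - 1))
        - 2 * b * ψ 0 * V 0 (max t 0))) = 0 := by
  obtain ⟨C, hC⟩ := hV.bounded
  have hWc := hV.continuous_extension
  have hWb : ∀ y t, |V y (max t 0)| ≤ C := fun y t => hC y _ (le_max_right _ _)
  have hz : ∀ t ∉ Ioi (0 : ℝ), τ t = 0 := fun t ht =>
    image_eq_zero_of_notMem_tsupport fun h => ht (hτ.tsupport_subset h)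
  have hz' : ∀ t ∉ Ioi (0 : ℝ), deriv τ t = 0 := fun t ht =>
    image_eq_zero_of_notMem_tsupport fun h => ht (hτ.deriv.tsupport_subset h)
  have hφ : tsupport (fun p : ℝ × ℝ => τ p.2 * ψ p.1) ⊆ tsupport ψ ×ˢ tsupport τ := by
    refine closure_minimal (fun p hp => ?_) ((isClosed_tsupport _).prod (isClosed_tsupport _))
    rw [Function.mem_support] at hp
    exact ⟨subset_tsupport _ (right_ne_zero_of_mul hp), subset_tsupport _ (left_ne_zero_of_mul hp)⟩
  have heq := hV.equation (fun p => τ p.2 * ψ p.1)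
    ((hτ.smooth.comp contDiff_snd).mul (hψ.smooth.comp contDiff_fst))
    (IsCompact.of_isClosed_subset (hψ.compact.isCompact.prod hτ.compact.isCompact)
      (isClosed_tsupport _) hφ)
    (fun p hp => hτ.tsupport_subset (hφ hp).2)
  have hWy : ∀ t, Continuous fun y => V y (max t 0) := fun t =>
    hWc.comp (by fun_prop : Continuous fun y : ℝ => (y, t))
  have hinner : ∀ t ∈ Ioi (0 : ℝ), (∫ y, (V y t * (deriv (fun s => τ s * ψ y) t
      + iteratedDeriv 2 (fun z => τ t * ψ z) y) - a ^ 2 * (V y t - 1) * (τ t * ψ y)))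
      = deriv τ t * (∫ y, ψ y * V y (max t 0)) + τ t *
      ((∫ y, deriv (deriv ψ) y * V y (max t 0)) - a ^ 2 * (∫ y, ψ y * (V y (max t 0) - 1))) := by
    intro t ht
    have ht0 : max t 0 = t := max_eq_left (mem_Ioi.1 ht).le
    have hWt := hWy t
    rw [ht0] at hWt
    rw [ht0]
    have hd1 : ∀ y, deriv (fun s => τ s * ψ y) t = deriv τ t * ψ y := fun y =>
      ((hτ.hasDerivAt t).mul_const (ψ y)).deriv
    have hd2 : ∀ y, iteratedDeriv 2 (fun z => τ t * ψ z) y = τ t * deriv (deriv ψ) y := by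
      intro y
      have h1 : deriv (fun z => τ t * ψ z) = fun z => τ t * deriv ψ z :=
        funext fun z => ((hψ.hasDerivAt z).const_mul (τ t)).deriv
      rw [iteratedDeriv_succ, iteratedDeriv_one, h1]
      exact ((hψ.deriv.hasDerivAt y).const_mul (τ t)).deriv
    simp only [hd1, hd2]
    have i1 := hψ.integrable_mul hWt
    have i2 := hψ.deriv.deriv.integrable_mul hWt
    have i3 : Integrable fun y => ψ y * (V y t - 1) :=
      hψ.integrable_mul (hWt.sub continuous_const)
    have i4 : Integrable fun y => deriv (deriv ψ) y * V y t - a ^ 2 * (ψ y * (V y t - 1)) :=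
      i2.sub (i3.const_mul _)
    rw [← integral_const_mul (a ^ 2), ← integral_sub i2 (i3.const_mul _), ← integral_const_mul,
      ← integral_const_mul, ← integral_add (i1.const_mul _) (i4.const_mul _)]
    congr 1
    ext y
    ring
  rw [setIntegral_congr_fun measurableSet_Ioi hinner, ← integral_const_mul] at heq
  have hv := continuous_integral_mul hWc hWb hψ.integrable
  have hh1 := continuous_integral_mul hWc hWb hψ.deriv.deriv.integrable
  have hh2 : Continuous fun t => ∫ y, ψ y * (V y (max t 0) - 1) :=
    continuous_integral_mul (W := fun y t => V y (max t 0) - 1) (C := C + 1)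
      (hWc.sub continuous_const) (fun y t => (abs_sub _ _).trans (by
        rw [abs_one]; linarith [hWb y t])) hψ.integrable
  have hξ : Continuous fun t => V 0 (max t 0) :=
    hWc.comp (by fun_prop : Continuous fun t : ℝ => ((0 : ℝ), t))
  have i1 : Integrable fun t => deriv τ t * (∫ y, ψ y * V y (max t 0)) + τ t *
      ((∫ y, deriv (deriv ψ) y * V y (max t 0)) - a ^ 2 * (∫ y, ψ y * (V y (max t 0) - 1))) :=
    (hτ.deriv.integrable_mul hv).add
      (hτ.integrable_mul (hh1.sub (continuous_const.mul hh2)))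
  have i2 : Integrable fun t => τ t * (2 * b * ψ 0 * V 0 (max t 0)) :=
    hτ.integrable_mul (continuous_const.mul hξ)
  have e2 : ∫ t in Ioi (0 : ℝ), 2 * b * (V 0 t * (τ t * ψ 0)) =
      ∫ t in Ioi (0 : ℝ), τ t * (2 * b * ψ 0 * V 0 (max t 0)) := by
    refine setIntegral_congr_fun measurableSet_Ioi fun t ht => ?_
    simp only [max_eq_left (mem_Ioi.1 ht).le]
    ring
  rw [e2, setIntegral_eq_integral_of_forall_compl_eq_zero fun t ht => by rw [hz t ht, hz' t ht]; simp,
    setIntegral_eq_integral_of_forall_compl_eq_zero fun t ht => by rw [hz t ht]; simp] at heq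
  have e3 := integral_sub i1 i2
  rw [heq, sub_self] at e3
  refine Eq.trans ?_ e3
  congr 1
  ext t
  ring

/-- For fixed ψ the pairing ∫ψV is a continuous function whose weak derivative is continuous, hence
the primitive of that derivative; the transform of a primitive is then the usual λ-rule. -/
lemma laplace_weak_equation (hV : IsBoundedSolution a b V₀ V) {lam : ℝ} (hlam : 0 < lam)
    {ψ : ℝ → ℝ} (hψ : IsTest univ ψ) :
    lam * (∫ y, ψ y * laplace (fun t => V y (max t 0)) lam) = (∫ y, ψ y * V₀ y) +
      ((∫ y, deriv (deriv ψ) y * laplace (fun t => V y (max t 0)) lam)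
        - a ^ 2 * ((∫ y, ψ y * laplace (fun t => V y (max t 0)) lam) - (∫ y, ψ y) / lam)
        - 2 * b * ψ 0 * laplace (fun t => V 0 (max t 0)) lam) := by
  obtain ⟨C, hC⟩ := hV.bounded
  have hWc := hV.continuous_extension
  have hWb : ∀ y t, |V y (max t 0)| ≤ C := fun y t => hC y _ (le_max_right _ _)
  have hv := continuous_integral_mul hWc hWb hψ.integrable
  have hvb := abs_integral_mul_le hWb hψ.integrable
  have hh1 := continuous_integral_mul hWc hWb hψ.deriv.deriv.integrable
  have hh1b := abs_integral_mul_le hWb hψ.deriv.deriv.integrable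
  have hξ : Continuous fun t => V 0 (max t 0) :=
    hWc.comp (by fun_prop : Continuous fun t : ℝ => ((0 : ℝ), t))
  have hsplit : ∀ t, ∫ y, ψ y * (V y (max t 0) - 1) = (∫ y, ψ y * V y (max t 0)) - ∫ y, ψ y := by
    intro t
    have hWt : Continuous fun y => V y (max t 0) :=
      hWc.comp (by fun_prop : Continuous fun y : ℝ => (y, t))
    rw [← integral_sub (hψ.integrable_mul hWt) hψ.integrable]
    simp only [mul_sub, mul_one]
  set v : ℝ → ℝ := fun t => ∫ y, ψ y * V y (max t 0) with hvdef
  set h₁ : ℝ → ℝ := fun t => ∫ y, deriv (deriv ψ) y * V y (max t 0) with hh₁def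
  set h : ℝ → ℝ := fun t => h₁ t - a ^ 2 * (v t - ∫ y, ψ y) - 2 * b * ψ 0 * V 0 (max t 0) with hh
  have hhc : Continuous h :=
    (hh1.sub (continuous_const.mul (hv.sub continuous_const))).sub (continuous_const.mul hξ)
  obtain ⟨c, hc⟩ := eq_primitive_of_weak_deriv isOpen_Ioi ordConnected_Ioi hv hhc fun τ hτ => by
    have := hV.weak_equation hψ hτ
    simp only [hsplit] at this
    exact this
  have hprim : Continuous fun t => ∫ s in (0 : ℝ)..t, h s :=
    continuous_iff_continuousAt.2 fun t => (hasDerivAt_primitive_of_continuous hhc t).continuousAt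
  -- The weak equation lives on t > 0 only; continuity of V up to t = 0 brings in the initial datum.
  have hc0 : v 0 = c := by
    have e1 : Tendsto v (𝓝[>] 0) (𝓝 (v 0)) := hv.continuousAt.tendsto.mono_left nhdsWithin_le_nhds
    have e2 : Tendsto (fun t => c + ∫ s in (0 : ℝ)..t, h s) (𝓝[>] 0)
        (𝓝 (c + ∫ s in (0 : ℝ)..0, h s)) :=
      (continuous_const.add hprim).continuousAt.tendsto.mono_left nhdsWithin_le_nhds
    rw [intervalIntegral.integral_same, add_zero] at e2
    refine tendsto_nhds_unique e1 (e2.congr' ?_)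
    filter_upwards [self_mem_nhdsWithin] with t ht using (hc t ht).symm
  have hv0 : v 0 = ∫ y, ψ y * V₀ y := by
    simp only [hvdef, max_self, hV.initial]
  have lξ := lapIntegrable_of_bounded hξ (hWb 0) hlam
  have lv := lapIntegrable_of_bounded hv hvb hlam
  have lh1 := lapIntegrable_of_bounded hh1 hh1b hlam
  have l1 : LapIntegrable (fun _ => (1 : ℝ)) lam :=
    lapIntegrable_of_bounded continuous_const (C := 1) (by simp) hlam
  have L1 : laplace (fun _ => (1 : ℝ)) lam = 1 / lam := by
    rw [laplace]
    simp only [mul_one]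
    rw [integral_exp_mul_Ioi (by linarith) 0]
    simp
  have hsum : ∀ s, exp (-lam * s) * h s = exp (-lam * s) * h₁ s - a ^ 2 * (exp (-lam * s) * v s
      - (exp (-lam * s) * 1) * ∫ y, ψ y) - 2 * b * ψ 0 * (exp (-lam * s) * V 0 (max s 0)) := by
    intro s
    simp only [hh]
    ring
  have lvc : IntegrableOn (fun s => a ^ 2 * (exp (-lam * s) * v s
      - (exp (-lam * s) * 1) * ∫ y, ψ y)) (Ioi 0) := (lv.sub (l1.mul_const _)).const_mul _
  have l12 : IntegrableOn (fun s => exp (-lam * s) * h₁ s - a ^ 2 * (exp (-lam * s) * v s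
      - (exp (-lam * s) * 1) * ∫ y, ψ y)) (Ioi 0) := lh1.sub lvc
  have lh : LapIntegrable h lam := by
    refine (l12.sub (lξ.const_mul (2 * b * ψ 0))).congr (Eventually.of_forall fun s => ?_)
    exact (hsum s).symm
  have Lh : laplace h lam = laplace h₁ lam - a ^ 2 * (laplace v lam - (∫ y, ψ y) / lam)
      - 2 * b * ψ 0 * laplace (fun t => V 0 (max t 0)) lam := by
    rw [laplace]
    simp only [hsum]
    rw [integral_sub l12 (lξ.const_mul _), integral_sub lh1 lvc, integral_const_mul,
      integral_const_mul, integral_sub lv (l1.mul_const _), integral_mul_const]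
    have : ∫ s in Ioi (0 : ℝ), exp (-lam * s) * 1 = 1 / lam := L1
    rw [this, laplace, laplace, laplace]
    ring
  have Lv : laplace v lam = v 0 / lam + laplace h lam / lam := by
    have e1 : laplace v lam = laplace (fun t => v 0 * 1 + conv (fun _ => 1) h t) lam := by
      refine laplace_congr (fun t ht => ?_) lam
      rw [hc t ht, hc0, conv]
      simp
    have e2 : ∀ s, exp (-lam * s) * (v 0 * 1 + conv (fun _ => 1) h s) =
        v 0 * (exp (-lam * s) * 1) + exp (-lam * s) * conv (fun _ => 1) h s := fun s => by ring
    rw [e1, laplace]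
    simp only [e2]
    rw [integral_add (l1.const_mul _) (l1.conv lh), integral_const_mul]
    have e3 := laplace_conv l1 lh
    rw [L1, laplace] at e3
    rw [laplace] at L1
    rw [e3, L1]
    ring
  rw [← laplace_integral_mul hWc hWb hψ.integrable hlam,
    ← laplace_integral_mul hWc hWb hψ.deriv.deriv.integrable hlam, ← hv0]
  rw [Lh] at Lv
  have Lv' : lam * laplace v lam = v 0 + (laplace h₁ lam - a ^ 2 * (laplace v lam
      - (∫ y, ψ y) / lam) - 2 * b * ψ 0 * laplace (fun t => V 0 (max t 0)) lam) := by
    rw [← add_div, eq_div_iff hlam.ne'] at Lv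
    rw [← Lv]
    ring
  exact Lv'

/-- The Laplace transform of the trace of a bounded solution at the origin. -/
theorem laplace_trace {w : ℝ → ℝ} (hV : IsBoundedSolution a b (fun y => 1 + w y) V) (hb : 0 < b)
    (hwc : Continuous w) {Cw : ℝ} (hw : ∀ z, |w z| ≤ Cw) {lam : ℝ} (hlam : 0 < lam) :
    laplace (fun t => V 0 t) lam =
      √(lam + a ^ 2) * (1 / lam + gVal a lam w) / (√(lam + a ^ 2) + b) := by
  obtain ⟨C, hC⟩ := hV.bounded
  have hWc := hV.continuous_extension
  have hWb : ∀ y t, |V y (max t 0)| ≤ C := fun y t => hC y _ (le_max_right _ _)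
  have hp : 0 < lam + a ^ 2 := by positivity
  set κ := √(lam + a ^ 2) with hκdef
  have hκ : 0 < κ := sqrt_pos.2 hp
  have hκ2 : κ ^ 2 = lam + a ^ 2 := sq_sqrt hp.le
  set L : ℝ → ℝ := fun y => laplace (fun t => V y (max t 0)) lam with hLdef
  have hLc : Continuous L := continuous_laplace_left hWc hWb hlam
  have hLb := abs_laplace_le hWb hlam
  set M := ∫ s in Ioi (0 : ℝ), exp (-lam * s) * C
  have hL0 : laplace (fun t => V 0 t) lam = L 0 :=
    laplace_congr (fun t ht => by simp only [max_eq_left (mem_Ioi.1 ht).le]) lam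
  set F : ℝ → ℝ := fun y => 1 + w y + a ^ 2 / lam with hF
  have hFc : Continuous F := (continuous_const.add hwc).add continuous_const
  have hFb : ∀ y, |F y| ≤ 1 + Cw + a ^ 2 / lam := by
    intro y
    have h0 : 0 ≤ a ^ 2 / lam := by positivity
    refine (abs_add_le _ _).trans (add_le_add ((abs_add_le _ _).trans ?_) (abs_of_nonneg h0).le)
    rw [abs_one]
    linarith [hw y]
  -- Chosen so that β|y|'' = 2b L(0) δ, which leaves L - β|y| with continuous second derivative κ²L
  -- - F.
  set β := b * L 0 with hβ
  obtain ⟨Z₁, hZ, hZ₁⟩ := exists_deriv_of_weak_deriv_two (Z := fun y => L y - β * |y|)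
    (r := fun y => κ ^ 2 * L y - F y) (hLc.sub (continuous_const.mul continuous_abs))
    ((continuous_const.mul hLc).sub hFc) fun ψ hψ => by
      have h := hV.laplace_weak_equation hlam hψ
      have h2 := integral_abs_mul_deriv_two hψ
      have i1 := hψ.integrable_mul hLc
      have i2 : Integrable fun y => ψ y * (1 + w y) :=
        hψ.integrable_mul (continuous_const.add hwc)
      have i3 : Integrable fun y => ψ y * (1 + w y) + ψ y * (a ^ 2 / lam) :=
        i2.add (hψ.integrable.mul_const _)
      have e1 : ∫ y, deriv (deriv ψ) y * (L y - β * |y|) =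
          (∫ y, deriv (deriv ψ) y * L y) - β * ∫ y, deriv (deriv ψ) y * |y| := by
        rw [← integral_const_mul, ← integral_sub (hψ.deriv.deriv.integrable_mul hLc)
          ((hψ.deriv.deriv.integrable_mul continuous_abs).const_mul β)]
        congr 1
        ext y
        ring
      have e2 : ∫ y, ψ y * (κ ^ 2 * L y - F y) = κ ^ 2 * (∫ y, ψ y * L y) -
          ((∫ y, ψ y * (1 + w y)) + (∫ y, ψ y) * (a ^ 2 / lam)) := by
        rw [← integral_const_mul, ← integral_mul_const,
          ← integral_add i2 (hψ.integrable.mul_const _),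
          ← integral_sub (i1.const_mul _) i3]
        congr 1
        ext y
        simp only [hF]
        ring
      rw [e1, e2, h2, hκ2]
      linear_combination -h
  -- Adding βy restores L on y ≥ 0 while staying differentiable at 0; the same is done for the
  -- reflected function below.
  have hr := integral_exp_mul_of_ode (g := fun y => L y - β * |y| + β * y)
    (g₁ := fun y => Z₁ y + β) (F := F) (M := M) hκ
    (fun y => by
      have : HasDerivAt (fun y => L y - β * |y| + β * y) (Z₁ y + β * 1) y :=
        (hZ y).add ((hasDerivAt_id y).const_mul β)
      rwa [mul_one] at this)
    (fun y hy => by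
      simpa [abs_of_nonneg hy] using (hZ₁ y).add_const β)
    (fun y hy => by simpa [abs_of_nonneg hy] using hLb y) hFb hFc
  have hl := integral_exp_mul_of_ode (g := fun y => L (-y) - β * |-y| + β * y)
    (g₁ := fun y => -Z₁ (-y) + β) (F := fun y => F (-y)) (M := M) hκ
    (fun y => by
      have : HasDerivAt (fun y => L (-y) - β * |-y| + β * y) (Z₁ (-y) * -1 + β * 1) y :=
        ((hZ (-y)).comp y (hasDerivAt_neg y)).add ((hasDerivAt_id y).const_mul β)
      rwa [mul_one, mul_neg_one] at this)
    (fun y hy => by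
      have := (((hZ₁ (-y)).comp y (hasDerivAt_neg y)).neg).add_const β
      simpa [abs_of_nonneg hy] using this)
    (fun y hy => by simpa [abs_of_nonneg hy] using hLb (-y)) (fun y => hFb (-y))
    (hFc.comp continuous_neg)
  have hexp := integrable_exp_neg_mul_abs hκ
  have iF : Integrable fun z => exp (-κ * |z|) * F z :=
    hexp.mul_bdd (c := 1 + Cw + a ^ 2 / lam) hFc.aestronglyMeasurable (Eventually.of_forall hFb)
  have iw : Integrable fun z => exp (-κ * |z|) * w z :=
    hexp.mul_bdd (c := Cw) hwc.aestronglyMeasurable (Eventually.of_forall hw)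
  -- Adding the half-line identities cancels the unknown slope Z₁(0).
  have hfull : ∫ z, exp (-κ * |z|) * F z = 2 * (b + κ) * L 0 := by
    rw [← intervalIntegral.integral_Iic_add_Ioi (b := 0) iF.integrableOn iF.integrableOn]
    have e1 : ∫ z in Iic (0 : ℝ), exp (-κ * |z|) * F z =
        ∫ y in Ioi (0 : ℝ), exp (-κ * y) * F (-y) := by
      have h := integral_comp_neg_Ioi (0 : ℝ) fun z => exp (-κ * |z|) * F z
      rw [neg_zero] at h
      rw [← h]
      refine setIntegral_congr_fun measurableSet_Ioi fun y hy => ?_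
      simp only [abs_neg, abs_of_pos (mem_Ioi.1 hy)]
    have e2 : ∫ z in Ioi (0 : ℝ), exp (-κ * |z|) * F z = ∫ y in Ioi (0 : ℝ), exp (-κ * y) * F y :=
      setIntegral_congr_fun measurableSet_Ioi fun y hy => by
        simp only [abs_of_pos (mem_Ioi.1 hy)]
    rw [e1, e2, hr, hl, hβ]
    simp only [neg_zero, abs_zero, mul_zero]
    ring
  have hval : ∫ z, exp (-κ * |z|) * F z = 2 / κ * (1 + a ^ 2 / lam) + 2 * κ * gVal a lam w := by
    rw [two_mul_sqrt_mul_gVal hp, ← integral_exp_neg_mul_abs hκ, ← integral_mul_const,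
      ← integral_add (hexp.mul_const _) iw]
    congr 1
    ext z
    simp only [hF]
    ring
  rw [hL0, eq_div_iff (by positivity)]
  rw [hval] at hfull
  have h3 : 2 / κ * (1 + a ^ 2 / lam) = 2 * κ / lam := by
    field_simp
    linear_combination -hκ2
  rw [h3] at hfull
  have h4 : κ * (1 / lam + gVal a lam w) = κ / lam + κ * gVal a lam w := by ring
  rw [h4]
  have h5 : 2 * κ / lam = 2 * (κ / lam) := by ring
  rw [h5] at hfull
  linarith

end IsBoundedSolution

end Solution

/-! ### Identification of the trace -/

lemma IsBoundedSolution.trace_eqOn {a b : ℝ} {w : ℝ → ℝ} {V : ℝ → ℝ → ℝ}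
    (hV : IsBoundedSolution a b (fun y => 1 + w y) V) (hb : 0 < b) (hwc : Continuous w) {C : ℝ}
    (hw : ∀ z, |w z| ≤ C) {ξ : ℝ → ℝ} (hξ0 : ξ 0 = 1 + w 0) (hξ : HasLaplace ξ fun lam =>
      √(lam + a ^ 2) * (1 / lam + gVal a lam w) / (√(lam + a ^ 2) + b)) :
    EqOn (fun t => V 0 t) ξ (Ici 0) := by
  obtain ⟨M, hM⟩ := hV.bounded
  have hc : ContinuousOn (fun t => V 0 t) (Ici 0) :=
    hV.continuousOn.comp (f := fun t : ℝ => ((0 : ℝ), t)) (by fun_prop) fun t ht => ht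
  have hl : HasLaplace (fun t => V 0 t) _ :=
    ⟨WeaklySingular.of_bounded (hc.mono Ioi_subset_Ici_self) fun t ht => hM 0 t (le_of_lt ht), by
      filter_upwards [eventually_gt_atTop 0] with lam hlam
        using hV.laplace_trace hb hwc hw hlam⟩
  intro t ht
  rcases eq_or_lt_of_le (mem_Ici.1 ht) with rfl | h
  · simp only [hV.initial, hξ0]
  · exact hl.eqOn hξ EventuallyEq.rfl h

/-! ### Exponential initial perturbations -/

section Exponential

variable (a b c μ : ℝ)

lemma exists_lipschitzWith_exp (hμ : 0 ≤ μ) :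
    ∃ K : NNReal, LipschitzWith K fun y : ℝ => -c * exp (-μ * |y|) := by
  refine ⟨⟨|c| * μ, by positivity⟩, LipschitzWith.of_dist_le_mul fun x y => ?_⟩
  have key : ∀ u v : ℝ, |u| ≤ |v| →
      exp (-μ * |u|) - exp (-μ * |v|) ≤ μ * |u - v| := by
    intro u v huv
    have h1 : exp (-μ * |v|) = exp (-μ * |u|) * exp (-(μ * (|v| - |u|))) := by
      rw [← exp_add]; ring_nf
    have h2 := add_one_le_exp (-(μ * (|v| - |u|)))
    have h3 : exp (-μ * |u|) ≤ 1 := exp_le_one_iff.2 (by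
      have := mul_nonneg hμ (abs_nonneg u); linarith)
    have h4 : |v| - |u| ≤ |u - v| := by
      rw [abs_sub_comm]; exact abs_sub_abs_le_abs_sub v u
    have h5 : 0 ≤ μ * (|v| - |u|) := mul_nonneg hμ (sub_nonneg.2 huv)
    calc exp (-μ * |u|) - exp (-μ * |v|)
        = exp (-μ * |u|) * (1 - exp (-(μ * (|v| - |u|)))) := by rw [h1]; ring
      _ ≤ 1 * (μ * (|v| - |u|)) := by
          refine mul_le_mul h3 (by linarith) ?_ zero_le_one
          rw [sub_nonneg, exp_le_one_iff]
          linarith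
      _ ≤ μ * |u - v| := by rw [one_mul]; exact mul_le_mul_of_nonneg_left h4 hμ
  have hdist : |exp (-μ * |x|) - exp (-μ * |y|)| ≤ μ * |x - y| := by
    have hexp : ∀ u v : ℝ, |u| ≤ |v| → exp (-μ * |v|) ≤ exp (-μ * |u|) := fun u v huv =>
      exp_le_exp.2 (by nlinarith)
    rcases le_total |x| |y| with h | h
    · rw [abs_of_nonneg (sub_nonneg.2 (hexp x y h))]
      exact key x y h
    · rw [abs_sub_comm, abs_of_nonneg (sub_nonneg.2 (hexp y x h)), abs_sub_comm]
      exact key y x h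
  rw [dist_eq, dist_eq, ← mul_sub, abs_mul, abs_neg]
  calc |c| * |exp (-μ * |x|) - exp (-μ * |y|)| ≤ |c| * (μ * |x - y|) := by gcongr
    _ = |c| * μ * |x - y| := by ring

lemma abs_exp_perturbation_le (hμ : 0 ≤ μ) (z : ℝ) : |-c * exp (-μ * |z|)| ≤ |c| := by
  rw [abs_mul, abs_neg, abs_exp]
  exact mul_le_of_le_one_right (abs_nonneg _) (exp_le_one_iff.2 (by
    have := mul_nonneg hμ (abs_nonneg z); linarith))

variable {a b c μ}

lemma two_mul_sqrt_mul_gVal_exp (hμ : 0 ≤ μ) {lam : ℝ} (hlam : 0 < lam) :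
    2 * √(lam + a ^ 2) * gVal a lam (fun y => -c * exp (-μ * |y|)) =
      -(2 * c / (√(lam + a ^ 2) + μ)) := by
  have hp : 0 < lam + a ^ 2 := by positivity
  have hx : 0 < √(lam + a ^ 2) := sqrt_pos.2 hp
  rw [two_mul_sqrt_mul_gVal hp]
  have : ∀ z, exp (-√(lam + a ^ 2) * |z|) * (-c * exp (-μ * |z|)) =
      -c * exp (-(√(lam + a ^ 2) + μ) * |z|) := by
    intro z
    rw [show -(√(lam + a ^ 2) + μ) * |z| = -√(lam + a ^ 2) * |z| + -μ * |z| by ring, exp_add]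
    ring
  simp only [this]
  rw [integral_const_mul, integral_exp_neg_mul_abs (by positivity)]
  ring

/-- The shift by a² - μ² produces the denominator λ + a² - μ² = (κ - μ)(κ + μ). It is nonzero for λ
> μ², and the factor κ - μ then cancels. -/
lemma hasLaplace_explicitSol (hb : 0 < b) (hμ : 0 ≤ μ) : HasLaplace (explicitSol a b c μ)
    fun lam => √(lam + a ^ 2) * (1 / lam + gVal a lam (fun y => -c * exp (-μ * |y|))) /
      (√(lam + a ^ 2) + b) := by
  have hq := hasLaplace_qKer hb.le
  have h1 := (((((hq.exp_mul (μ ^ 2)).primitive.const_mul (μ + b)).sub HasLaplace.one).const_mul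
    c).exp_mul (a ^ 2 - μ ^ 2))
  refine (HasLaplace.one.add (h1.sub ((hq.exp_mul (a ^ 2)).primitive.const_mul b))).congr
    (fun t _ => ?_) ?_
  · simp only [explicitSol]
    ring
  · filter_upwards [eventually_gt_atTop 0, eventually_gt_atTop (μ ^ 2)] with lam hlam hlam2
    have hp : 0 < lam + a ^ 2 := by positivity
    have hx : 0 < √(lam + a ^ 2) := sqrt_pos.2 hp
    have hg := two_mul_sqrt_mul_gVal_exp (a := a) (c := c) hμ hlam
    rw [show lam + (a ^ 2 - μ ^ 2) + μ ^ 2 = lam + a ^ 2 by ring]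
    have hx2 : √(lam + a ^ 2) ^ 2 = lam + a ^ 2 := sq_sqrt hp.le
    set x := √(lam + a ^ 2)
    set g := gVal a lam (fun y => -c * exp (-μ * |y|))
    have hxm : 0 < x + μ := by positivity
    have hxm' : x - μ ≠ 0 := by
      intro h0
      have hxμ : x = μ := by linarith
      rw [hxμ] at hx2
      nlinarith [sq_nonneg a]
    have hl : lam + (a ^ 2 - μ ^ 2) = (x - μ) * (x + μ) := by linear_combination -hx2
    have hxg : x * (1 / lam + g) = x / lam - c / (x + μ) := by
      linear_combination (1 / 2) * hg
    rw [hl, hxg]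
    field_simp
    ring

/-- No PDE solution is assumed: the function from `exists_trace` solves the equation, and comparing
transforms identifies both it and its source with the explicit ones. -/
theorem solvesMemoryEq_explicitSol (ha : 0 ≤ a) (hb : 0 < b) (hμ : 0 ≤ μ) :
    SolvesMemoryEq a b (expSource a c μ) (explicitSol a b c μ) ∧
      explicitSol a b c μ 0 = 1 - c := by
  have h0 : explicitSol a b c μ 0 = 1 - c := by
    simp [explicitSol, sub_eq_add_neg]
  obtain ⟨K, hK⟩ := exists_lipschitzWith_exp c μ hμ
  have hw := abs_exp_perturbation_le c μ hμ
  obtain ⟨ξ, hξ0, hξ, hsol⟩ := exists_trace (a := a) hb hK hw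
  obtain ⟨H, hH, hHi⟩ := exists_inverse_laplace a hK.continuous hw
  refine ⟨(hsol H hHi).congr ?_ ?_, h0⟩
  · have hl : HasLaplace H fun lam =>
        2 * √(lam + a ^ 2) * gVal a lam (fun y => -c * exp (-μ * |y|)) := ⟨hH, by
      filter_upwards [eventually_gt_atTop 0] with lam hlam using hHi.laplace_eq lam hlam⟩
    have := (hasLaplace_expSource a c ha hμ).eqOn (((hasLaplace_mKer a).const_mul (-c)).sub hl) ?_
    · intro t ht
      rw [this ht]
      simp [mul_comm]
    · filter_upwards [eventually_gt_atTop 0] with lam hlam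
      rw [two_mul_sqrt_mul_gVal_exp hμ hlam]
      ring
  · intro t ht
    rcases eq_or_lt_of_le (mem_Ici.1 ht) with rfl | h
    · rw [h0, hξ0]
      simp [sub_eq_add_neg]
    · exact (hasLaplace_explicitSol hb hμ).eqOn hξ EventuallyEq.rfl h

end Exponential

end LimitEq

theorem lemma2p2 (a b : ℝ) (ha : 0 ≤ a) (hb : 0 < b) :
    -- general bounded Lipschitz initial perturbation
    (∀ w₀ : ℝ → ℝ, (∃ C : ℝ, ∀ x, |w₀ x| ≤ C) → (∃ K : NNReal, LipschitzWith K w₀) →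
      (∃ H : ℝ → ℝ, LimitEq.IsInverseLaplace
        (fun lam => 2 * √(lam + a ^ 2) * LimitEq.gVal a lam w₀) H) ∧
      ∀ V : ℝ → ℝ → ℝ, LimitEq.IsBoundedSolution a b (fun y => 1 + w₀ y) V →
        ∀ H : ℝ → ℝ, LimitEq.IsInverseLaplace
          (fun lam => 2 * √(lam + a ^ 2) * LimitEq.gVal a lam w₀) H →
          LimitEq.SolvesMemoryEq a b
            (fun t => LimitEq.mKer a t * (V 0 0 - 1) - H t) (fun t => V 0 t)) ∧
    -- exponential initial perturbation
    (∀ c μ : ℝ, 0 ≤ μ →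
      (∀ V : ℝ → ℝ → ℝ,
        LimitEq.IsBoundedSolution a b (fun y => 1 + -c * exp (-μ * |y|)) V →
          LimitEq.SolvesMemoryEq a b (LimitEq.expSource a c μ) (fun t => V 0 t) ∧
          ∀ t, 0 ≤ t → V 0 t = LimitEq.explicitSol a b c μ t) ∧
      -- the explicit function is the solution of the explicit equation starting from `1 - c`
      LimitEq.SolvesMemoryEq a b (LimitEq.expSource a c μ) (LimitEq.explicitSol a b c μ) ∧
      LimitEq.explicitSol a b c μ 0 = 1 - c ∧
      ∀ ξ : ℝ → ℝ, LimitEq.SolvesMemoryEq a b (LimitEq.expSource a c μ) ξ → ξ 0 = 1 - c →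
        ∀ t, 0 ≤ t → ξ t = LimitEq.explicitSol a b c μ t) := by
  refine ⟨fun w₀ ⟨C, hC⟩ ⟨K, hK⟩ => ⟨?_, fun V hV H hH => ?_⟩, fun c μ hμ => ?_⟩
  · obtain ⟨H, -, hH⟩ := LimitEq.exists_inverse_laplace a hK.continuous hC
    exact ⟨H, hH⟩
  · obtain ⟨ξ, hξ0, hξ, hsol⟩ := LimitEq.exists_trace (a := a) hb hK hC
    refine (hsol H hH).congr (fun t _ => ?_) (hV.trace_eqOn hb hK.continuous hC hξ0 hξ)
    simp only [hV.initial, add_sub_cancel_left]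
  · obtain ⟨hsol, h0⟩ := LimitEq.solvesMemoryEq_explicitSol (c := c) ha hb hμ
    obtain ⟨K, hK⟩ := LimitEq.exists_lipschitzWith_exp c μ hμ
    have hw := LimitEq.abs_exp_perturbation_le c μ hμ
    refine ⟨fun V hV => ?_, hsol, h0, fun ξ hξ hξ0 t ht => hξ.unique hsol (hξ0.trans h0.symm) ht⟩
    have heq := hV.trace_eqOn hb hK.continuous hw (by simp [h0, sub_eq_add_neg])
      (LimitEq.hasLaplace_explicitSol hb hμ)
    exact ⟨hsol.congr (fun _ _ => rfl) heq, fun t ht => heq ht⟩
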